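/- Theorem 1.4. For each $n\ge 1$ let $a_1^{(n)},\dots,a_n^{(n)}\in\mathbb R$ be points, all contained in one compact set independent of $n$, and let $\mu_n=\frac1n\sum_{j=1}^n\delta_{a_j^{(n)}}$. Assume that $\mu_n$ converges weakly to an absolutely continuous probability measure $\mu$ with compact support, whose density $\psi$ is continuous as a function restricted to the support. For $t>0$ and $x\in\mathbb R$ put $$y_{t,\mu}(x)=\inf\Big\{y>0:\int\frac{d\mu(s)}{(x-s)^2+y^2}\le\frac1t\Big\},\qquad x_t=x+t\int\frac{(x-u)\psi(u)\,du}{(x-u)^2+y_{t,\mu}(x)^2}.$$ Let $g_{\mu_n}(z)=\int\log(z-x)\,d\mu_n(x)$ (principal branch), and for $x_0\in\mathbb R$ let $$K_{n,t}(x,y)=e^{-\frac n{2t}(x^2-y^2)+(x-y)x_0\frac nt}\,\frac{n}{(2\pi i)^2t}\int_{x_0-i\infty}^{x_0+i\infty}dz\int_\gamma dw\,\frac1{z-w}\,\frac{e^{\frac n{2t}((z-x)^2+2tg_{\mu_n}(z))}}{e^{\frac n{2t}((w-y)^2+2tg_{\mu_n}(w))}}+\frac{\sin\big((x-y)s\frac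 nt\big)}{\pi(x-y)},$$ where the last term is extended by continuity to $x=y$, and where $\gamma$ is a closed piecewise $C^1$ contour encircling all the points $a_j^{(n)}$ once in the positive sense and meeting the line $x_0+i\mathbb R$ precisely at the two points $x_0\pm is$, $s>0$, such that the open segment between them lies in the interior of $\gamma$. (The kernel does not depend on the choice of $\gamma$ and $s$; changing $x_0$ multiplies it by a factor $h(x)/h(y)$.) Let $x^*\in\mathbb R$ and let $\delta_n>0$ satisfy $\delta_n\to0$ and $n\delta_n^2\to\infty$, and suppose that for every $n$ the interval $[x^*-\delta_n,x^*+\delta_n]$ contains none of the points $a_1^{(n)},\dots,a_n^{(n)}$. If $\epsilon_n\in\mathbb R$ satisfies $\epsilon_n=o(\delta_n)$ and $t_n>0$ satisfies $t_n=o(\delta_n^2)$ as $n\to\infty$, then $$\lim_{n\to\infty}\epsilon_nK_{n,t_n}\big(x^*_{t_n}+\epsilon_nu,\;x^*_{t_n}+\epsilon_nv\big)=0$$ uniformly for $(u,v)$ in compact subsets of $\mathbb R^2$, and uniformly in the choice of $x_0\in[x^*-\delta_n,x^*+\delta_n]$ (and of $\gamma$, $s$) in the definition of $K_{n,t_n}$.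 -/

import Mathlib

open MeasureTheory Filter Topology Set Asymptotics
open scoped ENNReal BoundedContinuousFunction

noncomputable section

namespace DysonGap

/-- The empirical measure `(1/n) ∑ⱼ δ_{aⱼ}` of the points `a₁, …, aₙ`. -/
def empiricalMeasure {n : ℕ} (a : Fin n → ℝ) : Measure ℝ :=
  (n : ℝ≥0∞)⁻¹ • ∑ j, Measure.dirac (a j)

/-- The initial empirical measures converge weakly to a probability measure `μ` which is
absolutely continuous with density `ψ`, has compact support, and whose density is continuous
as a function restricted to the support. -/
structure ConvergesWeaklyToDensity (a : (n : ℕ) → Fin n → ℝ) (μ : Measure ℝ) (ψ : ℝ → ℝ) :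
    Prop where
  isProbabilityMeasure : IsProbabilityMeasure μ
  measurable_density : Measurable ψ
  density_nonneg : ∀ u, 0 ≤ ψ u
  eq_withDensity : μ = volume.withDensity (fun u => ENNReal.ofReal (ψ u))
  isCompact_support : IsCompact μ.support
  continuousOn_density : ContinuousOn ψ μ.support
  weak_convergence : ∀ f : ℝ →ᵇ ℝ,
    Tendsto (fun n => ∫ x, f x ∂(empiricalMeasure (a n))) atTop (𝓝 (∫ x, f x ∂μ))

/-- All the points `aⱼ⁽ⁿ⁾` lie in one compact subset of the real line. -/
def ContainedInCompact (a : (n : ℕ) → Fin n → ℝ) : Prop :=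
  ∃ S : Set ℝ, IsCompact S ∧ ∀ n j, a n j ∈ S

/-- `y_{t,μ}(x) = inf {y > 0 | ∫ dμ(s) / ((x - s)² + y²) ≤ 1/t}`. -/
def yFun (μ : Measure ℝ) (t x : ℝ) : ℝ :=
  sInf {y : ℝ | 0 < y ∧ ∫ s, 1 / ((x - s) ^ 2 + y ^ 2) ∂μ ≤ 1 / t}

/-- The path `t ↦ x_t = x + t ∫ (x - u) ψ(u) du / ((x - u)² + y_{t,μ}(x)²)`, where `ψ` is the
density of `μ`. -/
def path (μ : Measure ℝ) (ψ : ℝ → ℝ) (t x : ℝ) : ℝ :=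
  x + t * ∫ u, (x - u) * ψ u / ((x - u) ^ 2 + yFun μ t x ^ 2)

/-- `g_μ(z) = ∫ log(z - x) dμ(x)`, with the principal branch of the logarithm. -/
def logPotential (μ : Measure ℝ) (z : ℂ) : ℂ :=
  ∫ x, Complex.log (z - (x : ℂ)) ∂μ

/-- The contour integral `∫_γ f(w) dw` along a curve parametrized by `[0, 1]`. -/
def contourIntegral (γ : ℝ → ℂ) (f : ℂ → ℂ) : ℂ :=
  ∫ θ in (0 : ℝ)..1, f (γ θ) * deriv γ θ

/-- The winding number of a closed curve `γ` around a point `p` off the curve. -/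
def windingNumber (γ : ℝ → ℂ) (p : ℂ) : ℂ :=
  (2 * (Real.pi : ℂ) * Complex.I)⁻¹ * contourIntegral γ (fun w => 1 / (w - p))

/-- `γ : [0, 1] → ℂ` is a closed piecewise continuously differentiable curve (continuous, and
continuously differentiable with bounded derivative off finitely many parameters). -/
structure IsClosedContour (γ : ℝ → ℂ) : Prop where
  closed : γ 0 = γ 1
  continuousOn : ContinuousOn γ (Icc 0 1)
  piecewise_C1 : ∃ P : Finset ℝ,
    (∀ θ ∈ Ioo (0 : ℝ) 1 \ (P : Set ℝ), DifferentiableAt ℝ γ θ) ∧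
    ContinuousOn (deriv γ) (Ioo (0 : ℝ) 1 \ (P : Set ℝ)) ∧
    ∃ M : ℝ, ∀ θ ∈ Ioo (0 : ℝ) 1 \ (P : Set ℝ), ‖deriv γ θ‖ ≤ M

/-- The contours allowed in the kernel: `γ` encircles all the points `aⱼ` once in the positive
sense, it meets the vertical line `x₀ + iℝ` precisely at the two points `x₀ ± i s`, `s > 0`, and
the open line segment between these two points lies in the interior of `γ`. -/
structure IsAdmissibleContour {n : ℕ} (a : Fin n → ℝ) (x₀ s : ℝ) (γ : ℝ → ℂ) : Prop where
  isClosedContour : IsClosedContour γ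
  off_points : ∀ j, ((a j : ℝ) : ℂ) ∉ γ '' Icc 0 1
  encircles : ∀ j, windingNumber γ ((a j : ℝ) : ℂ) = 1
  s_pos : 0 < s
  inter_line : γ '' Icc 0 1 ∩ {z : ℂ | z.re = x₀} =
    {(x₀ : ℂ) + (s : ℂ) * Complex.I, (x₀ : ℂ) - (s : ℂ) * Complex.I}
  segment_inside : ∀ y : ℝ, |y| < s → windingNumber γ ((x₀ : ℂ) + (y : ℂ) * Complex.I) = 1

/-- The double integral
`∫_{x₀-i∞}^{x₀+i∞} dz ∫_γ dw (1/(z-w)) e^{(n/2t)((z-x)² + 2t g(z))} / e^{(n/2t)((w-y)² + 2t g(w))}`,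
where `g` is the logarithmic potential of the empirical measure of the points `a`. -/
def doubleIntegral {n : ℕ} (a : Fin n → ℝ) (t x₀ : ℝ) (γ : ℝ → ℂ) (x y : ℝ) : ℂ :=
  ∫ η : ℝ, Complex.I * contourIntegral γ (fun w =>
    1 / (((x₀ : ℂ) + (η : ℂ) * Complex.I) - w) *
      (Complex.exp ((n : ℂ) / (2 * (t : ℂ)) *
          ((((x₀ : ℂ) + (η : ℂ) * Complex.I) - (x : ℂ)) ^ 2 + 2 * (t : ℂ) *
            logPotential (empiricalMeasure a) ((x₀ : ℂ) + (η : ℂ) * Complex.I))) /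
        Complex.exp ((n : ℂ) / (2 * (t : ℂ)) *
          ((w - (y : ℂ)) ^ 2 + 2 * (t : ℂ) * logPotential (empiricalMeasure a) w))))

/-- The term `sin((x - y) s n / t) / (π (x - y))`, extended by continuity to `x = y`. -/
def sineTerm (n : ℕ) (t s x y : ℝ) : ℝ :=
  if x = y then s * (n / t) / Real.pi
  else Real.sin ((x - y) * s * (n / t)) / (Real.pi * (x - y))

/-- The eigenvalue correlation kernel `K_{n,t}(x, y)` with starting points `a`, written with the
vertical line `x₀ + iℝ` and the contour `γ` that meets this line at `x₀ ± i s`. -/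
def kernel {n : ℕ} (a : Fin n → ℝ) (t x₀ s : ℝ) (γ : ℝ → ℂ) (x y : ℝ) : ℂ :=
  (Real.exp (-(n / (2 * t)) * (x ^ 2 - y ^ 2) + (x - y) * x₀ * (n / t)) : ℂ) *
      ((n : ℂ) / ((2 * (Real.pi : ℂ) * Complex.I) ^ 2 * (t : ℂ))) *
      doubleIntegral a t x₀ γ x y +
    (sineTerm n t s x y : ℂ)

end DysonGap

end

/-! ### Cauchy theory for abstract cycles -/

noncomputable section

namespace DysonGap

/-! Since `exp (n * g)` is the polynomial `N = nodePoly a`, no branch of the logarithm survives, and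
the `w`-integrand is meromorphic with poles only at the nodes and at `w = z`. Inside the gap there
is nothing for the kernel to see. Replace `γ` by two rectangles, one on each side of the gap, and
move the `z`-line to its centre `m`. The residue at `w = z`, collected while `z` runs over the
segment inside `γ`, is exactly the negative of the sine term (`sineTerm_cancel`), so the kernel
equals the deformed double integral alone (`kernel_eq_twoRect`).

Only winding numbers of `γ` are known, so the deformation is algebraic rather than homotopic. The
divided difference of `N` splits the Cauchy kernel into a polynomial in `z`, whose coefficients are
moments of the cycle, and a residue term (`IsCycle.cauchy_kernel`). Partial fractions show that the
moments depend only on winding numbers around the nodes (`IsCycle.entire_div_prod`). The polynomial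
part is entire in `z`, so the line can be shifted freely.

Put `k = n / (2 * t)` and let `d` be the half-width of the gap. On the deformed contours the
Gaussians contribute `-k η²` and about `-k ρ²`, with `ρ = |Re w - m| ≥ d / 2`. The ratio `N z / N w`
costs at most `exp (4 n |z - w| / d)`, a small perturbation because `n = 2 k t` and `t` is much
smaller than `d²`. Hence the kernel is `O((k / d) exp (-k d² / 8))` (`norm_kernel_le`). The factor
`ε` absorbs `1 / d`, and `k ≤ (k d²)²` together with `k d² ≥ n` sends the bound to zero.

The path stays near the centre of the gap because it moves by at most `√t` (`abs_path_sub_le`), a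
consequence of AM-GM and the inequality defining `yFun`. -/

/-- An integration functional over a closed cycle carried by the compact set `Γ`: it is linear,
depends only on the values on `Γ`, and vanishes on functions that have a primitive near `Γ`. -/
structure IsCycle (Γ : Set ℂ) (Λ : (ℂ → ℂ) → ℂ) : Prop where
  congr : ∀ {f g : ℂ → ℂ}, EqOn f g Γ → Λ f = Λ g
  add : ∀ {f g : ℂ → ℂ}, ContinuousOn f Γ → ContinuousOn g Γ →
    Λ (fun w => f w + g w) = Λ f + Λ g
  const_mul : ∀ (c : ℂ) (f : ℂ → ℂ), Λ (fun w => c * f w) = c * Λ f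
  exact : ∀ {F f : ℂ → ℂ}, (∀ w ∈ Γ, HasDerivAt F (f w) w) → ContinuousOn f Γ → Λ f = 0

namespace IsCycle

variable {Γ Γ' : Set ℂ} {Λ Λ' : (ℂ → ℂ) → ℂ}

/-- Comparing two contours becomes the vanishing of a single cycle, their difference, with winding
number zero around each node. -/
theorem sub' (h : IsCycle Γ Λ) (h' : IsCycle Γ' Λ') :
    IsCycle (Γ ∪ Γ') (fun f => Λ f - Λ' f) where
  congr hfg := by
    simp only [h.congr (hfg.mono subset_union_left), h'.congr (hfg.mono subset_union_right)]
  add hf hg := by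
    simp only [h.add (hf.mono subset_union_left) (hg.mono subset_union_left),
      h'.add (hf.mono subset_union_right) (hg.mono subset_union_right)]
    ring
  const_mul c f := by simp only [h.const_mul, h'.const_mul]; ring
  exact hF hf := by
    simp only [h.exact (fun w hw => hF w (Or.inl hw)) (hf.mono subset_union_left),
      h'.exact (fun w hw => hF w (Or.inr hw)) (hf.mono subset_union_right), sub_zero]

theorem add' (h : IsCycle Γ Λ) (h' : IsCycle Γ' Λ') :
    IsCycle (Γ ∪ Γ') (fun f => Λ f + Λ' f) where
  congr hfg := by
    simp only [h.congr (hfg.mono subset_union_left), h'.congr (hfg.mono subset_union_right)]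
  add hf hg := by
    simp only [h.add (hf.mono subset_union_left) (hg.mono subset_union_left),
      h'.add (hf.mono subset_union_right) (hg.mono subset_union_right)]
    ring
  const_mul c f := by simp only [h.const_mul, h'.const_mul]; ring
  exact hF hf := by
    simp only [h.exact (fun w hw => hF w (Or.inl hw)) (hf.mono subset_union_left),
      h'.exact (fun w hw => hF w (Or.inr hw)) (hf.mono subset_union_right), add_zero]

theorem add_const_mul (h : IsCycle Γ Λ) {f g : ℂ → ℂ} (c : ℂ) (hf : ContinuousOn f Γ)
    (hg : ContinuousOn g Γ) : Λ (fun w => f w + c * g w) = Λ f + c * Λ g := by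
  rw [← h.const_mul]
  exact h.add hf (continuousOn_const.mul hg)

theorem sum (h : IsCycle Γ Λ) {ι : Type*} (s : Finset ι) (f : ι → ℂ → ℂ)
    (hf : ∀ i ∈ s, ContinuousOn (f i) Γ) :
    Λ (fun w => ∑ i ∈ s, f i w) = ∑ i ∈ s, Λ (f i) := by
  classical
  induction s using Finset.induction_on with
  | empty =>
    have := h.const_mul 0 (fun _ => 0)
    simpa using this
  | insert i s hi ih =>
    have hs : ∀ j ∈ s, ContinuousOn (f j) Γ := fun j hj => hf j (Finset.mem_insert_of_mem hj)
    simp only [Finset.sum_insert hi]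
    rw [h.add (hf i (Finset.mem_insert_self i s)) (continuousOn_finsetSum s hs), ih hs]

theorem entire (h : IsCycle Γ Λ) {f : ℂ → ℂ} (hf : Differentiable ℂ f) : Λ f = 0 := by
  obtain ⟨F, hF⟩ := hf.isExactOn_univ
  exact h.exact (fun w _ => hF w (mem_univ w)) hf.continuous.continuousOn

theorem continuousOn_inv_sub {p : ℂ} (hp : p ∉ Γ) :
    ContinuousOn (fun w : ℂ => 1 / (w - p)) Γ :=
  continuousOn_const.div (by fun_prop) fun w hw h0 => hp (by rwa [← sub_eq_zero.1 h0])

/-- Cauchy's formula for an entire function along a cycle. -/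
theorem entire_div_sub (h : IsCycle Γ Λ) {f : ℂ → ℂ} (hf : Differentiable ℂ f) {p : ℂ}
    (hp : p ∉ Γ) : Λ (fun w => f w / (w - p)) = f p * Λ (fun w => 1 / (w - p)) := by
  have hd : Differentiable ℂ (dslope f p) := by
    rw [← differentiableOn_univ, Complex.differentiableOn_dslope univ_mem, differentiableOn_univ]
    exact hf
  have hne : ∀ w ∈ Γ, w - p ≠ 0 := fun w hw h0 => hp (by rwa [← sub_eq_zero.1 h0])
  have key : EqOn (fun w => f w / (w - p)) (fun w => dslope f p w + f p * (1 / (w - p))) Γ := by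
    intro w hw
    have h0 := hne w hw
    simp only [dslope_of_ne f (sub_ne_zero.1 h0), slope_def_field]
    field_simp
    ring
  rw [h.congr key, h.add_const_mul _ hd.continuous.continuousOn (continuousOn_inv_sub hp),
    h.entire hd, zero_add]

theorem continuousOn_div_prod {f : ℂ → ℂ} (hf : Continuous f) {S : Multiset ℂ}
    (hS : ∀ p ∈ S, p ∉ Γ) : ContinuousOn (fun w => f w / (S.map fun p => w - p).prod) Γ := by
  refine hf.continuousOn.div ?_ ?_
  · exact (continuous_multiset_prod S fun p _ => by fun_prop).continuousOn
  · intro w hw h0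
    rw [Multiset.prod_eq_zero_iff, Multiset.mem_map] at h0
    obtain ⟨p, hpS, hp⟩ := h0
    exact hS p hpS (by rwa [← sub_eq_zero.1 hp])

/-- Only `k = 1` needs the winding number; every other power has a single-valued primitive off `p`.
-/
theorem one_div_pow (h : IsCycle Γ Λ) {p : ℂ} (hp : p ∉ Γ) (h1 : Λ (fun w => 1 / (w - p)) = 0)
    (k : ℕ) : Λ (fun w => 1 / (w - p) ^ k) = 0 := by
  have hne : ∀ w ∈ Γ, w - p ≠ 0 := fun w hw h0 => hp (by rwa [← sub_eq_zero.1 h0])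
  rcases k with _ | _ | k
  · simpa using h.entire (differentiable_const (1 : ℂ))
  · simpa using h1
  · have hk : (k + 1 : ℂ) ≠ 0 := by exact_mod_cast k.succ_ne_zero
    refine h.exact (F := fun w => -((k + 1 : ℂ)⁻¹) * ((w - p) ^ (k + 1))⁻¹) (fun w hw => ?_) ?_
    · have h0 := hne w hw
      have := ((((hasDerivAt_id w).sub_const p).pow (k + 1)).inv
        (pow_ne_zero _ h0)).const_mul (-((k + 1 : ℂ)⁻¹))
      refine this.congr_deriv ?_
      push_cast
      simp only [id, Pi.pow_apply]
      field_simp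
      ring
    · exact continuousOn_const.div (by fun_prop) fun w hw => pow_ne_zero _ (hne w hw)

/-- Partial fractions: two distinct poles can be separated at the price of two products with one
factor fewer, until only a pure power remains. -/
theorem one_div_prod (h : IsCycle Γ Λ) (S : Multiset ℂ) (hS : ∀ p ∈ S, p ∉ Γ)
    (h1 : ∀ p ∈ S, Λ (fun w => 1 / (w - p)) = 0) :
    Λ (fun w => 1 / (S.map fun p => w - p).prod) = 0 := by
  induction hn : Multiset.card S using Nat.strong_induction_on generalizing S with
  | _ n ih =>
  rcases Multiset.empty_or_exists_mem S with rfl | ⟨p, hp⟩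
  · simpa using h.entire (differentiable_const (1 : ℂ))
  by_cases hall : ∀ q ∈ S, q = p
  · rw [Multiset.eq_replicate_of_mem hall]
    simpa using h.one_div_pow (hS p hp) (h1 p hp) (Multiset.card S)
  · push Not at hall
    obtain ⟨q, hq, hqp⟩ := hall
    obtain ⟨S', rfl⟩ := Multiset.exists_cons_of_mem hp
    have hq' : q ∈ S' := by
      rcases Multiset.mem_cons.1 hq with h' | h'
      · exact absurd h' hqp
      · exact h'
    obtain ⟨S'', rfl⟩ := Multiset.exists_cons_of_mem hq'
    have hpS : ∀ r ∈ p ::ₘ S'', r ∈ p ::ₘ q ::ₘ S'' := by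
      intro r hr; simp only [Multiset.mem_cons] at hr ⊢; tauto
    have hqS : ∀ r ∈ q ::ₘ S'', r ∈ p ::ₘ q ::ₘ S'' := by
      intro r hr; simp only [Multiset.mem_cons] at hr ⊢; tauto
    have e1 := ih _ (by subst hn; simp) (p ::ₘ S'') (fun r hr => hS r (hpS r hr))
      (fun r hr => h1 r (hpS r hr)) rfl
    have e2 := ih _ (by subst hn; simp) (q ::ₘ S'') (fun r hr => hS r (hqS r hr))
      (fun r hr => h1 r (hqS r hr)) rfl
    have c1 := continuousOn_div_prod (f := fun _ => 1) continuous_const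
      (fun r hr => hS r (hpS r hr))
    have c2 := continuousOn_div_prod (f := fun _ => 1) continuous_const
      (fun r hr => hS r (hqS r hr))
    have key : EqOn (fun w => 1 / ((p ::ₘ q ::ₘ S'').map fun r => w - r).prod)
        (fun w => (p - q)⁻¹ * (1 / ((p ::ₘ S'').map fun r => w - r).prod
          + (-1) * (1 / ((q ::ₘ S'').map fun r => w - r).prod))) Γ := by
      intro w hw
      have hwp : w - p ≠ 0 := fun h0 => hS p (by simp) (by rwa [← sub_eq_zero.1 h0])
      have hwq : w - q ≠ 0 := fun h0 => hS q (by simp) (by rwa [← sub_eq_zero.1 h0])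
      have hpq : p - q ≠ 0 := sub_ne_zero.2 (Ne.symm hqp)
      have h0 : (S''.map fun r => w - r).prod ≠ 0 := by
        rw [Ne, Multiset.prod_eq_zero_iff, Multiset.mem_map]
        rintro ⟨r, hr, hr0⟩
        exact hS r (by simp [hr]) (by rwa [← sub_eq_zero.1 hr0])
      simp only [Multiset.map_cons, Multiset.prod_cons]
      field_simp
      ring
    rw [h.congr key, h.const_mul, h.add_const_mul _ c1 c2, e1, e2]
    simp

/-- If a cycle has winding number zero around all the poles, then it annihilates the quotient of
an entire function by the product of the corresponding linear factors. -/
theorem entire_div_prod (h : IsCycle Γ Λ) (S : Multiset ℂ) (hS : ∀ p ∈ S, p ∉ Γ)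
    (h1 : ∀ p ∈ S, Λ (fun w => 1 / (w - p)) = 0) {f : ℂ → ℂ} (hf : Differentiable ℂ f) :
    Λ (fun w => f w / (S.map fun p => w - p).prod) = 0 := by
  induction S using Multiset.induction_on generalizing f with
  | empty => simpa using h.entire hf
  | cons p S ih =>
    have hS' : ∀ r ∈ S, r ∉ Γ := fun r hr => hS r (Multiset.mem_cons_of_mem hr)
    have hd : Differentiable ℂ (dslope f p) := by
      rw [← differentiableOn_univ, Complex.differentiableOn_dslope univ_mem,
        differentiableOn_univ]
      exact hf
    have e1 := ih hS' (fun r hr => h1 r (Multiset.mem_cons_of_mem hr)) hd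
    have e2 := h.one_div_prod (p ::ₘ S) hS h1
    -- Write `f w = f p + (w - p) * dslope f p w`; the second summand cancels the factor `w - p` and
    -- has an entire numerator again.
    have key : EqOn (fun w => f w / ((p ::ₘ S).map fun r => w - r).prod)
        (fun w => dslope f p w / (S.map fun r => w - r).prod
          + f p * (1 / ((p ::ₘ S).map fun r => w - r).prod)) Γ := by
      intro w hw
      have hwp : w - p ≠ 0 := fun h0 => hS p (by simp) (by rwa [← sub_eq_zero.1 h0])
      have h0 : (S.map fun r => w - r).prod ≠ 0 := by
        rw [Ne, Multiset.prod_eq_zero_iff, Multiset.mem_map]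
        rintro ⟨r, hr, hr0⟩
        exact hS r (by simp [hr]) (by rwa [← sub_eq_zero.1 hr0])
      simp only [Multiset.map_cons, Multiset.prod_cons, dslope_of_ne f (sub_ne_zero.1 hwp),
        slope_def_field]
      field_simp
      ring
    rw [h.congr key, h.add_const_mul _ (continuousOn_div_prod hd.continuous hS')
      (continuousOn_div_prod continuous_const hS), e1, e2]
    simp

end IsCycle

/-- The product `∏ⱼ (z - aⱼ)`. -/
def nodePoly {n : ℕ} (a : Fin n → ℝ) (z : ℂ) : ℂ := ∏ j, (z - (a j : ℂ))

theorem nodePoly_eq_multiset {n : ℕ} (a : Fin n → ℝ) (z : ℂ) :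
    nodePoly a z = (((Finset.univ : Finset (Fin n)).val.map fun j => (a j : ℂ)).map
      fun p => z - p).prod := by
  rw [Multiset.map_map]; rfl

theorem IsCycle.entire_div_nodePoly {Γ : Set ℂ} {Λ : (ℂ → ℂ) → ℂ} (h : IsCycle Γ Λ) {n : ℕ}
    (a : Fin n → ℝ) (hS : ∀ j, (a j : ℂ) ∉ Γ)
    (h1 : ∀ j, Λ (fun w => 1 / (w - (a j : ℂ))) = 0) {f : ℂ → ℂ} (hf : Differentiable ℂ f) :
    Λ (fun w => f w / nodePoly a w) = 0 := by
  simp only [nodePoly_eq_multiset]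
  refine h.entire_div_prod _ ?_ ?_ hf
  · intro p hp
    obtain ⟨j, -, rfl⟩ := Multiset.mem_map.1 hp
    exact hS j
  · intro p hp
    obtain ⟨j, -, rfl⟩ := Multiset.mem_map.1 hp
    exact h1 j

theorem nodePoly_ne_zero {n : ℕ} {a : Fin n → ℝ} {z : ℂ} (hz : ∀ j, z ≠ a j) :
    nodePoly a z ≠ 0 :=
  Finset.prod_ne_zero_iff.2 fun j _ => sub_ne_zero.2 (hz j)

theorem continuous_nodePoly {n : ℕ} (a : Fin n → ℝ) : Continuous (nodePoly a) := by
  unfold nodePoly; fun_prop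

/-- The divided difference of `∏ⱼ (z - aⱼ)` is a polynomial in both variables. -/
theorem exists_nodePoly_sub {n : ℕ} (a : Fin n → ℝ) :
    ∃ q : ℕ → ℂ → ℂ, (∀ k, Differentiable ℂ (q k)) ∧ ∀ z w,
      nodePoly a z - nodePoly a w = (z - w) * ∑ k ∈ Finset.range n, z ^ k * q k w := by
  induction n with
  | zero => exact ⟨fun _ _ => 0, fun _ => differentiable_const _, by simp [nodePoly]⟩
  | succ n ih =>
    obtain ⟨q, hq, h⟩ := ih (fun j => a j.succ)
    have hN : Differentiable ℂ (nodePoly fun j : Fin n => a j.succ) := by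
      unfold nodePoly; fun_prop
    have hs : ∀ z, nodePoly a z = (z - a 0) * nodePoly (fun j : Fin n => a j.succ) z := by
      intro z; simp [nodePoly, Fin.prod_univ_succ]
    -- With `N z = (z - a 0) M z`, use `N z - N w = (z - a 0)(M z - M w) + (z - w) M w`.
    -- Multiplication by `z` shifts the index and `M w` fills the slot `k = 0`; the guard `k < n`
    -- drops the value `q n`, about which the induction says nothing.
    refine ⟨fun k w => (if k = 0 then nodePoly (fun j : Fin n => a j.succ) w else q (k - 1) w)
      - (if k < n then a 0 * q k w else 0), fun k => ?_, fun z w => ?_⟩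
    · beta_reduce
      split_ifs <;> fun_prop
    · have e1 : ∑ k ∈ Finset.range (n + 1), z ^ k *
          (if k = 0 then nodePoly (fun j : Fin n => a j.succ) w else q (k - 1) w) =
          z * (∑ k ∈ Finset.range n, z ^ k * q k w) +
            nodePoly (fun j : Fin n => a j.succ) w := by
        rw [Finset.sum_range_succ', Finset.mul_sum]
        simp [pow_succ']
        exact Finset.sum_congr rfl fun k _ => by ring
      have e2 : ∑ k ∈ Finset.range (n + 1), z ^ k * (if k < n then a 0 * q k w else 0) =
          a 0 * ∑ k ∈ Finset.range n, z ^ k * q k w := by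
        rw [Finset.sum_range_succ, Finset.mul_sum]
        simp only [lt_irrefl, if_false, mul_zero, add_zero]
        refine Finset.sum_congr rfl fun k hk => ?_
        rw [if_pos (Finset.mem_range.1 hk)]; ring
      simp only [mul_sub, Finset.sum_sub_distrib]
      rw [e1, e2, hs, hs]
      linear_combination (z - a 0) * h z w

end DysonGap

end

/-! ### Closed contours and rectangle boundaries as cycles, and their winding numbers -/

noncomputable section

namespace DysonGap

theorem IsClosedContour.intervalIntegrable {γ : ℝ → ℂ} (h : IsClosedContour γ) {f : ℂ → ℂ}
    (hf : ContinuousOn f (γ '' Icc 0 1)) :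
    IntervalIntegrable (fun θ => f (γ θ) * deriv γ θ) volume 0 1 := by
  obtain ⟨P, -, -, M, hM⟩ := h.piecewise_C1
  have hc : ContinuousOn (fun θ => f (γ θ)) (Icc 0 1) :=
    hf.comp h.continuousOn fun θ hθ => mem_image_of_mem γ hθ
  have hd : IntervalIntegrable (deriv γ) volume 0 1 := by
    rw [intervalIntegrable_iff_integrableOn_Ioo_of_le zero_le_one]
    refine Measure.integrableOn_of_bounded (M := M) (by simp)
      (measurable_deriv γ).aestronglyMeasurable ?_
    rw [ae_restrict_iff' measurableSet_Ioo]
    have hP : ∀ᵐ θ : ℝ, θ ∉ (P : Set ℝ) :=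
      (P.countable_toSet).ae_notMem volume
    filter_upwards [hP] with θ hθ hθ'
    exact hM θ ⟨hθ', hθ⟩
  exact hd.continuousOn_mul (by rwa [uIcc_of_le zero_le_one])

/-- Integration along a closed contour is integration over a cycle. -/
theorem IsClosedContour.isCycle {γ : ℝ → ℂ} (h : IsClosedContour γ) :
    IsCycle (γ '' Icc 0 1) (contourIntegral γ) where
  congr {f g} hfg := by
    refine intervalIntegral.integral_congr fun θ hθ => ?_
    rw [uIcc_of_le zero_le_one] at hθ
    simp only [hfg (mem_image_of_mem γ hθ)]
  add {f g} hf hg := by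
    simp only [contourIntegral, add_mul]
    exact intervalIntegral.integral_add (h.intervalIntegrable hf) (h.intervalIntegrable hg)
  const_mul c f := by
    simp only [contourIntegral, mul_assoc]
    exact intervalIntegral.integral_const_mul _ _
  exact {F f} hF hf := by
    have hi := h.intervalIntegrable hf
    obtain ⟨P, hP, -⟩ := h.piecewise_C1
    have hFc : ContinuousOn F (γ '' Icc 0 1) :=
      fun w hw => (hF w hw).continuousAt.continuousWithinAt
    have := integral_eq_of_hasDerivAt_off_countable_of_le (fun θ => F (γ θ))
      (fun θ => f (γ θ) * deriv γ θ) zero_le_one P.countable_toSet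
      (hFc.comp h.continuousOn fun θ hθ => mem_image_of_mem γ hθ)
      (fun θ hθ => (hF _ (mem_image_of_mem γ (Ioo_subset_Icc_self hθ.1))).comp θ
        (hP θ hθ).hasDerivAt) hi
    rw [contourIntegral, this, h.closed, sub_self]

/-- The boundary of the rectangle `[l, r] × [-b, b]`. -/
def rectBoundary (l r b : ℝ) : Set ℂ :=
  ((fun x : ℝ => (x : ℂ) + (-b : ℝ) * Complex.I) '' Icc l r ∪
    (fun x : ℝ => (x : ℂ) + (b : ℝ) * Complex.I) '' Icc l r) ∪
  ((fun y : ℝ => (r : ℂ) + (y : ℝ) * Complex.I) '' Icc (-b) b ∪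
    (fun y : ℝ => (l : ℂ) + (y : ℝ) * Complex.I) '' Icc (-b) b)

/-- The positively oriented integral over the boundary of the rectangle `[l, r] × [-b, b]`. -/
def rectIntegral (l r b : ℝ) (f : ℂ → ℂ) : ℂ :=
  ((∫ x in l..r, f ((x : ℂ) + (-b : ℝ) * Complex.I)) -
    ∫ x in l..r, f ((x : ℂ) + (b : ℝ) * Complex.I)) +
  (Complex.I * (∫ y in (-b)..b, f ((r : ℂ) + (y : ℝ) * Complex.I)) -
    Complex.I * ∫ y in (-b)..b, f ((l : ℂ) + (y : ℝ) * Complex.I))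

section rect

variable {l r b : ℝ}

theorem bottom_mem {x : ℝ} (hx : x ∈ Icc l r) :
    (x : ℂ) + (-b : ℝ) * Complex.I ∈ rectBoundary l r b := Or.inl (Or.inl ⟨x, hx, rfl⟩)

theorem top_mem {x : ℝ} (hx : x ∈ Icc l r) :
    (x : ℂ) + (b : ℝ) * Complex.I ∈ rectBoundary l r b := Or.inl (Or.inr ⟨x, hx, rfl⟩)

theorem right_mem {y : ℝ} (hy : y ∈ Icc (-b) b) :
    (r : ℂ) + (y : ℝ) * Complex.I ∈ rectBoundary l r b := Or.inr (Or.inl ⟨y, hy, rfl⟩)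

theorem left_mem {y : ℝ} (hy : y ∈ Icc (-b) b) :
    (l : ℂ) + (y : ℝ) * Complex.I ∈ rectBoundary l r b := Or.inr (Or.inr ⟨y, hy, rfl⟩)

theorem horizontal_integrable (hl : l ≤ r) {c : ℝ} {f : ℂ → ℂ}
    (hf : ContinuousOn f ((fun x : ℝ => (x : ℂ) + (c : ℝ) * Complex.I) '' Icc l r)) :
    IntervalIntegrable (fun x : ℝ => f ((x : ℂ) + (c : ℝ) * Complex.I)) volume l r := by
  refine ContinuousOn.intervalIntegrable ?_
  rw [uIcc_of_le hl]
  exact hf.comp (by fun_prop) fun x hx => mem_image_of_mem _ hx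

theorem vertical_integrable (hl : l ≤ r) {c : ℝ} {f : ℂ → ℂ}
    (hf : ContinuousOn f ((fun y : ℝ => (c : ℂ) + (y : ℝ) * Complex.I) '' Icc l r)) :
    IntervalIntegrable (fun y : ℝ => f ((c : ℂ) + (y : ℝ) * Complex.I)) volume l r := by
  refine ContinuousOn.intervalIntegrable ?_
  rw [uIcc_of_le hl]
  exact hf.comp (by fun_prop) fun x hx => mem_image_of_mem _ hx

theorem horizontal_integral (hl : l ≤ r) {c : ℝ} {F f : ℂ → ℂ}
    (hF : ∀ x ∈ Icc l r, HasDerivAt F (f ((x : ℂ) + (c : ℝ) * Complex.I))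
      ((x : ℂ) + (c : ℝ) * Complex.I))
    (hf : ContinuousOn f ((fun x : ℝ => (x : ℂ) + (c : ℝ) * Complex.I) '' Icc l r)) :
    ∫ x in l..r, f ((x : ℂ) + (c : ℝ) * Complex.I) =
      F ((r : ℂ) + (c : ℝ) * Complex.I) - F ((l : ℂ) + (c : ℝ) * Complex.I) := by
  refine intervalIntegral.integral_eq_sub_of_hasDerivAt
    (f := fun x : ℝ => F ((x : ℂ) + (c : ℝ) * Complex.I)) (fun x hx => ?_)
    (horizontal_integrable hl hf)
  rw [uIcc_of_le hl] at hx
  have h1 : HasDerivAt (fun x : ℝ => (x : ℂ) + (c : ℝ) * Complex.I) 1 x :=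
    (Complex.ofRealCLM.hasDerivAt (x := x)).add_const _
  exact ((hF x hx).comp x h1).congr_deriv (mul_one _)

theorem vertical_integral (hl : l ≤ r) {c : ℝ} {F f : ℂ → ℂ}
    (hF : ∀ y ∈ Icc l r, HasDerivAt F (f ((c : ℂ) + (y : ℝ) * Complex.I))
      ((c : ℂ) + (y : ℝ) * Complex.I))
    (hf : ContinuousOn f ((fun y : ℝ => (c : ℂ) + (y : ℝ) * Complex.I) '' Icc l r)) :
    Complex.I * ∫ y in l..r, f ((c : ℂ) + (y : ℝ) * Complex.I) =
      F ((c : ℂ) + (r : ℝ) * Complex.I) - F ((c : ℂ) + (l : ℝ) * Complex.I) := by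
  rw [← intervalIntegral.integral_const_mul]
  refine intervalIntegral.integral_eq_sub_of_hasDerivAt
    (f := fun y : ℝ => F ((c : ℂ) + (y : ℝ) * Complex.I)) (fun y hy => ?_)
    ((vertical_integrable hl hf).const_mul _)
  rw [uIcc_of_le hl] at hy
  have h1 : HasDerivAt (fun y : ℝ => (c : ℂ) + (y : ℝ) * Complex.I) Complex.I y := by
    simpa using ((Complex.ofRealCLM.hasDerivAt (x := y)).mul_const Complex.I).const_add (c : ℂ)
  exact ((hF y hy).comp y h1).congr_deriv (mul_comm _ _)

/-- Integration along the boundary of a rectangle is integration over a cycle. -/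
theorem rect_isCycle (hl : l ≤ r) (hb : 0 ≤ b) :
    IsCycle (rectBoundary l r b) (rectIntegral l r b) where
  congr {f g} hfg := by
    have hb' : -b ≤ b := by linarith
    unfold rectIntegral
    congr 2
    · refine intervalIntegral.integral_congr fun x hx => ?_
      rw [uIcc_of_le hl] at hx
      exact hfg (bottom_mem hx)
    · refine intervalIntegral.integral_congr fun x hx => ?_
      rw [uIcc_of_le hl] at hx
      exact hfg (top_mem hx)
    · congr 1
      refine intervalIntegral.integral_congr fun x hx => ?_
      rw [uIcc_of_le hb'] at hx
      exact hfg (right_mem hx)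
    · congr 1
      refine intervalIntegral.integral_congr fun x hx => ?_
      rw [uIcc_of_le hb'] at hx
      exact hfg (left_mem hx)
  add {f g} hf hg := by
    have hb' : -b ≤ b := by linarith
    unfold rectIntegral
    rw [intervalIntegral.integral_add
        (horizontal_integrable hl (hf.mono fun w hw => Or.inl (Or.inl hw)))
        (horizontal_integrable hl (hg.mono fun w hw => Or.inl (Or.inl hw))),
      intervalIntegral.integral_add
        (horizontal_integrable hl (hf.mono fun w hw => Or.inl (Or.inr hw)))
        (horizontal_integrable hl (hg.mono fun w hw => Or.inl (Or.inr hw))),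
      intervalIntegral.integral_add
        (vertical_integrable hb' (hf.mono fun w hw => Or.inr (Or.inl hw)))
        (vertical_integrable hb' (hg.mono fun w hw => Or.inr (Or.inl hw))),
      intervalIntegral.integral_add
        (vertical_integrable hb' (hf.mono fun w hw => Or.inr (Or.inr hw)))
        (vertical_integrable hb' (hg.mono fun w hw => Or.inr (Or.inr hw)))]
    ring
  const_mul c f := by
    simp only [rectIntegral, intervalIntegral.integral_const_mul]
    ring
  exact {F f} hF hf := by
    have hb' : -b ≤ b := by linarith
    unfold rectIntegral
    rw [horizontal_integral hl (fun x hx => hF _ (bottom_mem hx))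
        (hf.mono fun w hw => Or.inl (Or.inl hw)),
      horizontal_integral hl (fun x hx => hF _ (top_mem hx))
        (hf.mono fun w hw => Or.inl (Or.inr hw)),
      vertical_integral hb' (fun x hx => hF _ (right_mem hx))
        (hf.mono fun w hw => Or.inr (Or.inl hw)),
      vertical_integral hb' (fun x hx => hF _ (left_mem hx))
        (hf.mono fun w hw => Or.inr (Or.inr hw))]
    ring

/-- Points of the boundary of a rectangle in coordinates. -/
theorem mem_rectBoundary (hl : l ≤ r) (hb : 0 ≤ b) {w : ℂ} (hw : w ∈ rectBoundary l r b) :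
    w.re ∈ Icc l r ∧ w.im ∈ Icc (-b) b ∧
      (w.im = -b ∨ w.im = b ∨ w.re = r ∨ w.re = l) := by
  rcases hw with (⟨x, hx, rfl⟩ | ⟨x, hx, rfl⟩) | (⟨x, hx, rfl⟩ | ⟨x, hx, rfl⟩)
  · simpa [hb] using hx
  · simpa [hb] using hx
  · simpa [hl] using hx
  · simpa [hl] using hx

/-- A rectangle to the left of `p` does not wind around `p`. -/
theorem rectIntegral_of_re_lt (hl : l ≤ r) (hb : 0 ≤ b) {p : ℂ} (hp : r < p.re) :
    rectIntegral l r b (fun w => 1 / (w - p)) = 0 := by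
  have hre : ∀ w ∈ rectBoundary l r b, w.re < p.re := fun w hw =>
    lt_of_le_of_lt (mem_rectBoundary hl hb hw).1.2 hp
  refine (rect_isCycle hl hb).exact (F := fun w => Complex.log (p - w)) (fun w hw => ?_)
    (IsCycle.continuousOn_inv_sub fun h => (hre p h).false)
  have hm : p - w ∈ Complex.slitPlane := Or.inl (by simpa using hre w hw)
  refine (((hasDerivAt_id w).const_sub p).clog hm).congr_deriv ?_
  rw [id, ← neg_sub w p, neg_div_neg_eq]

/-- A rectangle to the right of `p` does not wind around `p`. -/
theorem rectIntegral_of_lt_re (hl : l ≤ r) (hb : 0 ≤ b) {p : ℂ} (hp : p.re < l) :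
    rectIntegral l r b (fun w => 1 / (w - p)) = 0 := by
  have hre : ∀ w ∈ rectBoundary l r b, p.re < w.re := fun w hw =>
    lt_of_lt_of_le hp (mem_rectBoundary hl hb hw).1.1
  refine (rect_isCycle hl hb).exact (F := fun w => Complex.log (w - p)) (fun w hw => ?_)
    (IsCycle.continuousOn_inv_sub fun h => (hre p h).false)
  exact ((hasDerivAt_id w).sub_const p).clog (Or.inl (by simpa using hre w hw))

/-- A rectangle winds once around a real point in its interior. -/
theorem rectIntegral_of_mem (hb : 0 < b) {p : ℝ} (hp : p ∈ Ioo l r) :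
    rectIntegral l r b (fun w => 1 / (w - p)) = 2 * Real.pi * Complex.I := by
  obtain ⟨h1, h2⟩ := hp
  have hl : l ≤ r := by linarith
  have hb' : -b ≤ b := by linarith
  have hnot : (p : ℂ) ∉ rectBoundary l r b := by
    intro h
    have := (mem_rectBoundary hl hb.le h).2.2
    simp only [Complex.ofReal_im, Complex.ofReal_re] at this
    rcases this with h | h | h | h <;> linarith
  have hc := IsCycle.continuousOn_inv_sub hnot
  have hlog : ∀ w : ℂ, w - p ∈ Complex.slitPlane →
      HasDerivAt (fun w => Complex.log (w - p)) (1 / (w - p)) w := fun w hw =>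
    ((hasDerivAt_id w).sub_const (p : ℂ)).clog hw
  have hlog' : ∀ w : ℂ, p - w ∈ Complex.slitPlane →
      HasDerivAt (fun w => Complex.log (p - w)) (1 / (w - p)) w := fun w hw => by
    refine (((hasDerivAt_id w).const_sub (p : ℂ)).clog hw).congr_deriv ?_
    rw [id, ← neg_sub w (p : ℂ), neg_div_neg_eq]
  unfold rectIntegral
  -- The left side crosses the cut of `log (w - p)`, so `log (p - w)` serves there. The two
  -- primitives differ by `∓π i` at the upper and lower left corners, and these jumps add up to `2 π
  -- i`.
  rw [horizontal_integral hl
        (fun x hx => hlog _ (Or.inr (by simpa using hb.ne')))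
        (hc.mono fun w hw => Or.inl (Or.inl hw)),
      horizontal_integral hl (fun x hx => hlog _ (Or.inr (by simpa using hb.ne')))
        (hc.mono fun w hw => Or.inl (Or.inr hw)),
      vertical_integral hb' (fun x hx => hlog _ (Or.inl (by simpa using h2)))
        (hc.mono fun w hw => Or.inr (Or.inl hw)),
      vertical_integral hb' (fun x hx => hlog' _ (Or.inl (by simpa using h1)))
        (hc.mono fun w hw => Or.inr (Or.inr hw))]
  have e1 : Complex.log ((p : ℂ) - (l + (b : ℝ) * Complex.I)) =
      Complex.log ((l : ℂ) + (b : ℝ) * Complex.I - p) - Real.pi * Complex.I := by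
    rw [← neg_sub, Complex.log, Complex.log,
      Complex.arg_neg_eq_arg_sub_pi_of_im_pos (by simpa using hb), norm_neg]
    push_cast; ring
  have e2 : Complex.log ((p : ℂ) - (l + (-b : ℝ) * Complex.I)) =
      Complex.log ((l : ℂ) + (-b : ℝ) * Complex.I - p) + Real.pi * Complex.I := by
    rw [← neg_sub, Complex.log, Complex.log,
      Complex.arg_neg_eq_arg_add_pi_of_im_neg (by simpa using hb), norm_neg]
    push_cast; ring
  rw [e1, e2]
  ring

end rect

/-- A closed contour does not wind around a point from which a vertical ray to infinity avoids the
contour. -/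
theorem IsCycle.one_div_sub_of_ray {Γ : Set ℂ} {Λ : (ℂ → ℂ) → ℂ} (h : IsCycle Γ Λ) {p c : ℂ}
    (hc : c ≠ 0) (hp : ∀ w ∈ Γ, c * (w - p) ∈ Complex.slitPlane) :
    Λ (fun w => 1 / (w - p)) = 0 := by
  refine h.exact (F := fun w => Complex.log (c * (w - p))) (fun w hw => ?_)
    (IsCycle.continuousOn_inv_sub fun h => ?_)
  · refine ((((hasDerivAt_id w).sub_const p).const_mul c).clog (hp w hw)).congr_deriv ?_
    simp only [id, mul_one]
    rw [div_mul_eq_div_div, div_self hc]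
  · simpa using hp p h

/-- An admissible contour does not wind around the points of the vertical line outside the segment
cut out by the contour. -/
theorem IsAdmissibleContour.integral_outside {n : ℕ} {a : Fin n → ℝ} {x₀ s : ℝ} {γ : ℝ → ℂ}
    (h : IsAdmissibleContour a x₀ s γ) {η : ℝ} (hη : s < |η|) :
    contourIntegral γ (fun w => 1 / (w - ((x₀ : ℂ) + (η : ℂ) * Complex.I))) = 0 := by
  have hs := h.s_pos
  have hη0 : η ≠ 0 := by rintro rfl; simp at hη; linarith
  -- Multiplying by `η i` places the cut of the logarithm on the vertical ray from the point away
  -- from the real axis; the contour meets the line only at heights `±s`, which are too low.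
  refine h.isClosedContour.isCycle.one_div_sub_of_ray (c := (η : ℂ) * Complex.I)
    (by simpa using hη0) fun w hw => ?_
  by_contra hslit
  simp only [Complex.mem_slitPlane_iff, not_or, not_lt, not_not] at hslit
  obtain ⟨h1, h2⟩ := hslit
  simp at h1 h2
  have hre : w.re = x₀ := by
    rcases h2 with h2 | h2
    · exact absurd h2 hη0
    · linarith
  have hmem : w ∈ γ '' Icc 0 1 ∩ {z : ℂ | z.re = x₀} := ⟨hw, hre⟩
  rw [h.inter_line] at hmem
  have him : w.im = s ∨ w.im = -s := by
    rcases hmem with rfl | hmem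
    · left; simp
    · right; rw [mem_singleton_iff] at hmem; subst hmem; simp
  have h3 : η ^ 2 ≤ η * w.im := by nlinarith
  have h4 : η * w.im ≤ |η| * s := by
    rcases him with e | e <;> rw [e]
    · exact mul_le_mul_of_nonneg_right (le_abs_self η) hs.le
    · have := mul_le_mul_of_nonneg_right (neg_le_abs η) hs.le
      linarith
  rw [← sq_abs] at h3
  nlinarith [abs_pos.2 hη0]

end DysonGap

end

/-! ### Shifting the line, the potential as a polynomial, and the two-rectangle cycle -/

noncomputable section

namespace DysonGap

/-- Shifting the vertical line of integration of an entire function with Gaussian decay. -/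
theorem integral_vertical_line_eq {f : ℂ → ℂ} (hf : Differentiable ℂ f) {c₀ c₁ C b : ℝ}
    (hb : 0 < b)
    (hbound : ∀ σ ∈ uIcc c₀ c₁, ∀ η : ℝ,
      ‖f ((σ : ℂ) + (η : ℂ) * Complex.I)‖ ≤ C * Real.exp (-b * η ^ 2)) :
    ∫ η : ℝ, f ((c₀ : ℂ) + (η : ℂ) * Complex.I) =
      ∫ η : ℝ, f ((c₁ : ℂ) + (η : ℂ) * Complex.I) := by
  have hcont := hf.continuous
  have hint : ∀ σ ∈ uIcc c₀ c₁, Integrable fun η : ℝ => f ((σ : ℂ) + (η : ℂ) * Complex.I) :=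
    fun σ hσ => ((integrable_exp_neg_mul_sq hb).const_mul C).mono'
      (by fun_prop : Continuous fun η : ℝ => f ((σ : ℂ) + (η : ℂ) * Complex.I)).aestronglyMeasurable
      (Eventually.of_forall (hbound σ hσ))
  have hlim : ∀ σ ∈ uIcc c₀ c₁, Tendsto
      (fun T : ℝ => ∫ y in (-T)..T, f ((σ : ℂ) + (y : ℂ) * Complex.I)) atTop
      (𝓝 (∫ y : ℝ, f ((σ : ℂ) + (y : ℂ) * Complex.I))) := fun σ hσ =>
    intervalIntegral_tendsto_integral (hint σ hσ) tendsto_neg_atTop_atBot tendsto_id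
  have hdecay : Tendsto (fun T : ℝ => C * Real.exp (-b * T ^ 2) * |c₁ - c₀|) atTop (𝓝 0) := by
    have h1 : Tendsto (fun T : ℝ => -b * T ^ 2) atTop atBot :=
      (tendsto_pow_atTop two_ne_zero).const_mul_atTop_of_neg (by linarith)
    simpa using ((Real.tendsto_exp_atBot.comp h1).const_mul C).mul_const |c₁ - c₀|
  have hhor : ∀ g : ℝ → ℝ, (∀ T, g T ^ 2 = T ^ 2) → Tendsto
      (fun T : ℝ => ∫ x in c₀..c₁, f ((x : ℂ) + (g T : ℂ) * Complex.I)) atTop (𝓝 0) := by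
    intro g hg
    refine squeeze_zero_norm (fun T => ?_) hdecay
    refine intervalIntegral.norm_integral_le_of_norm_le_const fun x hx => ?_
    rw [← hg T]
    exact hbound x (uIoc_subset_uIcc hx) (g T)
  have hzero : ∀ T : ℝ, ((∫ x in c₀..c₁, f ((x : ℂ) + ((-T : ℝ) : ℂ) * Complex.I)) -
      (∫ x in c₀..c₁, f ((x : ℂ) + (T : ℂ) * Complex.I))) +
      Complex.I * (∫ y in (-T)..T, f ((c₁ : ℂ) + (y : ℂ) * Complex.I)) -
      Complex.I * (∫ y in (-T)..T, f ((c₀ : ℂ) + (y : ℂ) * Complex.I)) = 0 := by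
    intro T
    have := Complex.integral_boundary_rect_eq_zero_of_differentiableOn f
      ((c₀ : ℂ) + ((-T : ℝ) : ℂ) * Complex.I) ((c₁ : ℂ) + (T : ℂ) * Complex.I)
      hf.differentiableOn
    simpa using this
  have hl := (((hhor (fun T => -T) (fun T => neg_sq T)).sub (hhor (fun T => T) fun _ => rfl)).add
    ((hlim c₁ right_mem_uIcc).const_mul Complex.I)).sub
    ((hlim c₀ left_mem_uIcc).const_mul Complex.I)
  simp only [hzero] at hl
  have := tendsto_nhds_unique hl tendsto_const_nhds
  have h2 : Complex.I * ((∫ η : ℝ, f ((c₁ : ℂ) + (η : ℂ) * Complex.I)) -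
      ∫ η : ℝ, f ((c₀ : ℂ) + (η : ℂ) * Complex.I)) = 0 := by
    rw [← this]; ring
  rcases mul_eq_zero.1 h2 with h | h
  · exact absurd h Complex.I_ne_zero
  · exact (sub_eq_zero.1 h).symm

theorem norm_cexp_mul_sub_sq (κ x : ℝ) (z : ℂ) :
    ‖Complex.exp ((κ : ℂ) * (z - x) ^ 2)‖ = Real.exp (κ * ((z.re - x) ^ 2 - z.im ^ 2)) := by
  rw [Complex.norm_exp]
  congr 1
  simp [pow_two]

/-- A Gaussian times a polynomial decays like a Gaussian on vertical strips. -/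
theorem exists_gaussian_bound {κ : ℝ} (hκ : 0 < κ) (x A : ℝ) (n : ℕ) (c : ℕ → ℂ) :
    ∃ C : ℝ, ∀ σ : ℝ, |σ| ≤ A → ∀ η : ℝ,
      ‖Complex.exp ((κ : ℂ) * (((σ : ℂ) + (η : ℂ) * Complex.I) - x) ^ 2) *
        ∑ k ∈ Finset.range n, ((σ : ℂ) + (η : ℂ) * Complex.I) ^ k * c k‖ ≤
        C * Real.exp (-(κ / 2) * η ^ 2) := by
  -- Powers are bounded by `|z|^k ≤ k! exp |z|`, and `|η| ≤ κ η² / 2 + 1 / (2 κ)` pays for the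
  -- exponential with half of the Gaussian rate.
  refine ⟨∑ k ∈ Finset.range n,
    (Nat.factorial k * ‖c k‖) * Real.exp (κ * (A + |x|) ^ 2 + A + 1 / (2 * κ)),
    fun σ hσ η => ?_⟩
  rw [norm_mul, norm_cexp_mul_sub_sq, Finset.sum_mul]
  refine (mul_le_mul_of_nonneg_left (norm_sum_le _ _) (Real.exp_pos _).le).trans ?_
  rw [Finset.mul_sum]
  refine Finset.sum_le_sum fun k _ => ?_
  have hz : ‖(σ : ℂ) + (η : ℂ) * Complex.I‖ ≤ A + |η| := by
    refine (norm_add_le _ _).trans ?_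
    simp [hσ]
  have hpow : ‖(σ : ℂ) + (η : ℂ) * Complex.I‖ ^ k ≤ Nat.factorial k * Real.exp (A + |η|) := by
    have h1 := Real.pow_div_factorial_le_exp _ (norm_nonneg ((σ : ℂ) + (η : ℂ) * Complex.I)) k
    rw [div_le_iff₀ (by positivity)] at h1
    have := Real.exp_le_exp.2 hz
    nlinarith [(Nat.cast_pos (α := ℝ)).2 (Nat.factorial_pos k)]
  rw [norm_mul, norm_pow]
  have hre : ((σ : ℂ) + (η : ℂ) * Complex.I).re = σ := by simp
  have him : ((σ : ℂ) + (η : ℂ) * Complex.I).im = η := by simp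
  rw [hre, him]
  have hexp : Real.exp (κ * ((σ - x) ^ 2 - η ^ 2)) * Real.exp (A + |η|) ≤
      Real.exp (κ * (A + |x|) ^ 2 + A + 1 / (2 * κ)) * Real.exp (-(κ / 2) * η ^ 2) := by
    rw [← Real.exp_add, ← Real.exp_add, Real.exp_le_exp]
    have h1 : (σ - x) ^ 2 ≤ (A + |x|) ^ 2 := by
      rw [← sq_abs]
      exact pow_le_pow_left₀ (abs_nonneg _)
        ((abs_sub σ x).trans (by linarith)) 2
    have h2 : |η| ≤ κ / 2 * η ^ 2 + 1 / (2 * κ) := by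
      have h3 : κ / 2 * η ^ 2 + 1 / (2 * κ) - |η| = (κ * |η| - 1) ^ 2 / (2 * κ) := by
        field_simp
        rw [← sq_abs η]
        ring
      have : 0 ≤ (κ * |η| - 1) ^ 2 / (2 * κ) := by positivity
      linarith
    nlinarith [mul_le_mul_of_nonneg_left h1 hκ.le]
  calc Real.exp (κ * ((σ - x) ^ 2 - η ^ 2)) *
        (‖(σ : ℂ) + (η : ℂ) * Complex.I‖ ^ k * ‖c k‖)
      ≤ Real.exp (κ * ((σ - x) ^ 2 - η ^ 2)) *
        ((Nat.factorial k * Real.exp (A + |η|)) * ‖c k‖) := by gcongr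
    _ = (Nat.factorial k * ‖c k‖) *
        (Real.exp (κ * ((σ - x) ^ 2 - η ^ 2)) * Real.exp (A + |η|)) := by ring
    _ ≤ (Nat.factorial k * ‖c k‖) *
        (Real.exp (κ * (A + |x|) ^ 2 + A + 1 / (2 * κ)) * Real.exp (-(κ / 2) * η ^ 2)) := by
        gcongr
    _ = _ := by ring

/-- The factor `n` cancels the normalization of the measure, and exponentiating undoes each
principal logarithm even on its cut. -/
theorem exp_logPotential {n : ℕ} (hn : n ≠ 0) (a : Fin n → ℝ) {z : ℂ} (hz : ∀ j, z ≠ a j) :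
    Complex.exp (n * logPotential (empiricalMeasure a) z) = nodePoly a z := by
  have h1 : logPotential (empiricalMeasure a) z =
      (n : ℂ)⁻¹ * ∑ j, Complex.log (z - a j) := by
    rw [logPotential, empiricalMeasure, integral_smul_measure, integral_finsetSum_measure]
    · simp only [integral_dirac]
      simp
    · intro j _
      exact integrable_dirac (by simp [enorm_lt_top])
  rw [h1, ← mul_assoc, mul_inv_cancel₀ (by exact_mod_cast hn), one_mul, Complex.exp_sum, nodePoly]
  exact Finset.prod_congr rfl fun j _ => Complex.exp_log (sub_ne_zero.2 (hz j))

theorem exp_phase {n : ℕ} (hn : n ≠ 0) (a : Fin n → ℝ) {t : ℝ} (ht : t ≠ 0) (x : ℝ) {z : ℂ}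
    (hz : ∀ j, z ≠ a j) :
    Complex.exp ((n : ℂ) / (2 * (t : ℂ)) * ((z - (x : ℂ)) ^ 2 + 2 * (t : ℂ) *
      logPotential (empiricalMeasure a) z)) =
      Complex.exp (((n / (2 * t) : ℝ) : ℂ) * (z - x) ^ 2) * nodePoly a z := by
  rw [← exp_logPotential hn a hz, ← Complex.exp_add]
  congr 1
  have : (t : ℂ) ≠ 0 := by exact_mod_cast ht
  push_cast
  field_simp

/-- Integration of a Cauchy-type kernel along a cycle, in terms of moments. -/
theorem IsCycle.cauchy_kernel {Γ : Set ℂ} {Λ : (ℂ → ℂ) → ℂ} (h : IsCycle Γ Λ) {n : ℕ}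
    {a : Fin n → ℝ} (ha : ∀ j, (a j : ℂ) ∉ Γ) {q : ℕ → ℂ → ℂ} (hq : ∀ k, Differentiable ℂ (q k))
    (hqa : ∀ z w, nodePoly a z - nodePoly a w = (z - w) * ∑ k ∈ Finset.range n, z ^ k * q k w)
    {f : ℂ → ℂ} (hf : Differentiable ℂ f) {z : ℂ} (hz : z ∉ Γ) :
    Λ (fun w => 1 / (z - w) * (nodePoly a z * (f w / nodePoly a w))) =
      (∑ k ∈ Finset.range n, z ^ k * Λ (fun w => f w * q k w / nodePoly a w)) -
        f z * Λ (fun w => 1 / (w - z)) := by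
  have hN : ∀ w ∈ Γ, nodePoly a w ≠ 0 := fun w hw =>
    nodePoly_ne_zero fun j hj => ha j (hj ▸ hw)
  have hk : ∀ k, ContinuousOn (fun w => f w * q k w / nodePoly a w) Γ := fun k =>
    (hf.continuous.mul (hq k).continuous).continuousOn.div (continuous_nodePoly a).continuousOn hN
  have hfz : ContinuousOn (fun w => f w / (w - z)) Γ :=
    hf.continuous.continuousOn.div (by fun_prop) fun w hw h0 => hz (by rwa [← sub_eq_zero.1 h0])
  -- Replacing `N z` by `N w + (z - w) ∑ z^k q k w` separates the variables: the sum loses the pole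
  -- at `w = z`, and what remains is a Cauchy kernel for the entire `f`.
  have key : EqOn (fun w => 1 / (z - w) * (nodePoly a z * (f w / nodePoly a w)))
      (fun w => (∑ k ∈ Finset.range n, z ^ k * (f w * q k w / nodePoly a w)) +
        (-1) * (f w / (w - z))) Γ := by
    intro w hw
    have h0 := hN w hw
    have h1 : z - w ≠ 0 := fun h0 => hz (by rwa [sub_eq_zero.1 h0])
    have h2 : w - z ≠ 0 := fun h0 => hz (by rwa [← sub_eq_zero.1 h0])
    have h3 : ∑ k ∈ Finset.range n, z ^ k * (f w * q k w / nodePoly a w) =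
        f w / nodePoly a w * ∑ k ∈ Finset.range n, z ^ k * q k w := by
      rw [Finset.mul_sum]
      exact Finset.sum_congr rfl fun k _ => by ring
    have h4 : ∑ k ∈ Finset.range n, z ^ k * q k w =
        (nodePoly a z - nodePoly a w) / (z - w) := by
      rw [hqa]; field_simp
    simp only [h3, h4]
    rw [← neg_sub z w]
    field_simp
    ring
  have hzk : ∀ k, ContinuousOn (fun w => z ^ k * (f w * q k w / nodePoly a w)) Γ := fun k =>
    continuousOn_const.mul (hk k)
  rw [h.congr key, h.add_const_mul _ (continuousOn_finsetSum _ fun k _ => hzk k) hfz,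
    h.entire_div_sub hf hz, h.sum _ _ fun k _ => hzk k]
  simp only [h.const_mul]
  ring

/-- Integration over the boundaries of the two rectangles `[m - R, m - e] × [-b, b]` and
`[m + e, m + R] × [-b, b]`. -/
def twoRectIntegral (m e R b : ℝ) (f : ℂ → ℂ) : ℂ :=
  rectIntegral (m - R) (m - e) b f + rectIntegral (m + e) (m + R) b f

/-- The union of the boundaries of the two rectangles. -/
def twoRectBoundary (m e R b : ℝ) : Set ℂ :=
  rectBoundary (m - R) (m - e) b ∪ rectBoundary (m + e) (m + R) b

section twoRect

variable {m e R b : ℝ}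

theorem twoRect_isCycle (heR : e ≤ R) (hb : 0 ≤ b) :
    IsCycle (twoRectBoundary m e R b) (twoRectIntegral m e R b) :=
  (rect_isCycle (by linarith) hb).add' (rect_isCycle (by linarith) hb)

theorem mem_twoRectBoundary (he : 0 ≤ e) (heR : e ≤ R) (hb : 0 ≤ b) {w : ℂ}
    (hw : w ∈ twoRectBoundary m e R b) :
    e ≤ |w.re - m| ∧ |w.im| ≤ b ∧ (|w.im| = b ∨ |w.re - m| = e ∨ |w.re - m| = R) := by
  rcases hw with hw | hw
  · obtain ⟨h1, h2, h3⟩ := mem_rectBoundary (by linarith) hb hw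
    have e1 : |w.re - m| = m - w.re := by
      rw [abs_sub_comm]; exact abs_of_nonneg (by linarith [h1.2])
    rw [e1]
    refine ⟨by linarith [h1.2], abs_le.2 h2, ?_⟩
    rcases h3 with h | h | h | h
    · left; rw [h, abs_neg, abs_of_nonneg hb]
    · left; rw [h, abs_of_nonneg hb]
    · right; left; linarith
    · right; right; linarith
  · obtain ⟨h1, h2, h3⟩ := mem_rectBoundary (by linarith) hb hw
    have e1 : |w.re - m| = w.re - m := abs_of_nonneg (by linarith [h1.1])
    rw [e1]
    refine ⟨by linarith [h1.1], abs_le.2 h2, ?_⟩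
    rcases h3 with h | h | h | h
    · left; rw [h, abs_neg, abs_of_nonneg hb]
    · left; rw [h, abs_of_nonneg hb]
    · right; right; linarith
    · right; left; linarith

theorem ofReal_notMem_twoRectBoundary (he : 0 ≤ e) (heR : e ≤ R) (hb : 0 < b) {p : ℝ}
    (hp : e < |p - m|) (hpR : |p - m| < R) : (p : ℂ) ∉ twoRectBoundary m e R b := by
  intro h
  obtain ⟨-, -, h3⟩ := mem_twoRectBoundary he heR hb.le h
  simp only [Complex.ofReal_im, Complex.ofReal_re, abs_zero] at h3
  rcases h3 with h | h | h <;> linarith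

theorem twoRectIntegral_winding (he : 0 ≤ e) (hb : 0 < b) {p : ℝ}
    (hp : e < |p - m|) (hpR : |p - m| < R) :
    twoRectIntegral m e R b (fun w => 1 / (w - p)) = 2 * Real.pi * Complex.I := by
  unfold twoRectIntegral
  obtain ⟨h1, h2⟩ := abs_lt.1 hpR
  rcases lt_abs.1 hp with h | h
  · rw [rectIntegral_of_re_lt (by linarith) hb.le (by simp; linarith),
      rectIntegral_of_mem hb ⟨by linarith, by linarith⟩, zero_add]
  · rw [rectIntegral_of_lt_re (l := m + e) (by linarith) hb.le (by simp; linarith),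
      rectIntegral_of_mem hb ⟨by linarith, by linarith⟩, add_zero]

/-- The central line runs between the rectangles, so after deformation no residue at `w = z` arises.
-/
theorem twoRectIntegral_middle (he : 0 < e) (heR : e ≤ R) (hb : 0 < b) {p : ℂ}
    (hp : p.re = m) : twoRectIntegral m e R b (fun w => 1 / (w - p)) = 0 := by
  unfold twoRectIntegral
  rw [rectIntegral_of_re_lt (by linarith) hb.le (by linarith),
    rectIntegral_of_lt_re (by linarith) hb.le (by linarith), zero_add]

/-- Deformation of an admissible contour into the two rectangles. -/
theorem IsAdmissibleContour.integral_eq_twoRect {n : ℕ} {a : Fin n → ℝ} {x₀ s : ℝ} {γ : ℝ → ℂ}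
    (h : IsAdmissibleContour a x₀ s γ) (he : 0 ≤ e) (heR : e ≤ R) (hb : 0 < b)
    (hae : ∀ j, e < |a j - m|) (haR : ∀ j, |a j - m| < R) {f : ℂ → ℂ}
    (hf : Differentiable ℂ f) :
    contourIntegral γ (fun w => f w / nodePoly a w) =
      twoRectIntegral m e R b (fun w => f w / nodePoly a w) := by
  have hcyc := h.isClosedContour.isCycle.sub' (twoRect_isCycle (m := m) heR hb.le)
  refine sub_eq_zero.1 (hcyc.entire_div_nodePoly a (fun j => ?_) (fun j => ?_) hf)
  · rintro (hj | hj)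
    · exact h.off_points j hj
    · exact ofReal_notMem_twoRectBoundary he heR hb (hae j) (haR j) hj
  · have h1 := h.encircles j
    rw [windingNumber, inv_mul_eq_one₀ Complex.two_pi_I_ne_zero] at h1
    simp only [← h1, twoRectIntegral_winding he hb (hae j) (haR j), sub_self]

end twoRect

end DysonGap

end

/-! ### Cancellation of the sine term and the deformed kernel -/

noncomputable section

namespace DysonGap

/-- The part of the double integral over the line produced by the poles on the line cancels the
sine term. -/
theorem sineTerm_cancel (n : ℕ) (hn : n ≠ 0) {t : ℝ} (ht : 0 < t) (x₀ s x y : ℝ) :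
    (Real.exp (-(n / (2 * t)) * (x ^ 2 - y ^ 2) + (x - y) * x₀ * (n / t)) : ℂ) *
      ((n : ℂ) / ((2 * (Real.pi : ℂ) * Complex.I) ^ 2 * (t : ℂ))) *
      (2 * Real.pi * ∫ η in (-s)..s,
        Complex.exp (((n / (2 * t) : ℝ) : ℂ) * (((x₀ : ℂ) + (η : ℂ) * Complex.I) - x) ^ 2) *
        Complex.exp (-((n / (2 * t) : ℝ) : ℂ) * (((x₀ : ℂ) + (η : ℂ) * Complex.I) - y) ^ 2)) +
      (sineTerm n t s x y : ℂ) = 0 := by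
  have ht' : (t : ℂ) ≠ 0 := by exact_mod_cast ht.ne'
  have hn' : (n : ℂ) ≠ 0 := by exact_mod_cast hn
  have hpi : (Real.pi : ℂ) ≠ 0 := by exact_mod_cast Real.pi_ne_zero
  set A : ℂ := (Real.exp (-(n / (2 * t)) * (x ^ 2 - y ^ 2) + (x - y) * x₀ * (n / t)) : ℂ) with hA
  -- On the line the two Gaussians cancel their quadratic parts, and the prefactor `A` removes
  -- everything except this linear phase in `η`.
  set c : ℂ := -(n / t) * (x - y) * Complex.I with hc
  have h1 : ∀ η : ℝ,
      A * (Complex.exp (((n / (2 * t) : ℝ) : ℂ) * (((x₀ : ℂ) + (η : ℂ) * Complex.I) - x) ^ 2) *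
      Complex.exp (-((n / (2 * t) : ℝ) : ℂ) * (((x₀ : ℂ) + (η : ℂ) * Complex.I) - y) ^ 2)) =
      Complex.exp (c * η) := by
    intro η
    rw [hA, Complex.ofReal_exp, ← Complex.exp_add, ← Complex.exp_add, hc]
    congr 1
    push_cast
    field_simp
    ring
  have h2 : A * ((n : ℂ) / ((2 * (Real.pi : ℂ) * Complex.I) ^ 2 * (t : ℂ))) *
      (2 * Real.pi * ∫ η in (-s)..s,
        Complex.exp (((n / (2 * t) : ℝ) : ℂ) * (((x₀ : ℂ) + (η : ℂ) * Complex.I) - x) ^ 2) *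
        Complex.exp (-((n / (2 * t) : ℝ) : ℂ) * (((x₀ : ℂ) + (η : ℂ) * Complex.I) - y) ^ 2)) =
      -(n / (2 * Real.pi * t)) * ∫ η in (-s)..s, Complex.exp (c * (η : ℝ)) := by
    simp only [← h1]
    rw [intervalIntegral.integral_const_mul]
    have : (2 * (Real.pi : ℂ) * Complex.I) ^ 2 = -(4 * Real.pi ^ 2) := by
      rw [mul_pow, Complex.I_sq]; ring
    rw [this]
    generalize (∫ η in (-s)..s, _ : ℂ) = J
    field_simp
    ring
  rw [h2]
  by_cases hxy : x = y
  · have hc0 : c = 0 := by rw [hc, hxy]; simp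
    simp only [hc0, zero_mul, Complex.exp_zero, sineTerm, if_pos hxy]
    rw [intervalIntegral.integral_const]
    simp only [Complex.real_smul, mul_one]
    push_cast
    field_simp
    ring
  · have hxy' : (x : ℂ) - y ≠ 0 := sub_ne_zero.2 (by exact_mod_cast hxy)
    have hc0 : c ≠ 0 := by
      rw [hc]
      exact mul_ne_zero (mul_ne_zero (neg_ne_zero.2 (div_ne_zero hn' ht')) hxy') Complex.I_ne_zero
    rw [integral_exp_mul_complex hc0, sineTerm, if_neg hxy]
    push_cast
    rw [Complex.sin]
    have e1 : c * (s : ℂ) = -(((x : ℂ) - y) * s * (n / t)) * Complex.I := by rw [hc]; ring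
    have e2 : c * (-(s : ℂ)) = (((x : ℂ) - y) * s * (n / t)) * Complex.I := by rw [hc]; ring
    rw [e1, e2, hc]
    generalize Complex.exp (-(((x : ℂ) - y) * s * (n / t)) * Complex.I) = E1
    generalize Complex.exp ((((x : ℂ) - y) * s * (n / t)) * Complex.I) = E2
    field_simp
    rw [Complex.I_sq]
    ring

variable {m e R b : ℝ}

/-- The kernel as a double integral over a vertical line through the gap and two rectangles
on its two sides. -/
theorem kernel_eq_twoRect {n : ℕ} (hn : n ≠ 0) {a : Fin n → ℝ} {t : ℝ} (ht : 0 < t)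
    {x₀ s : ℝ} {γ : ℝ → ℂ} (h : IsAdmissibleContour a x₀ s γ) (hx₀ : ∀ j, a j ≠ x₀)
    (he : 0 < e) (heR : e ≤ R) (hb : 0 < b)
    (hae : ∀ j, e < |a j - m|) (haR : ∀ j, |a j - m| < R) (x y : ℝ) :
    kernel a t x₀ s γ x y =
      (Real.exp (-(n / (2 * t)) * (x ^ 2 - y ^ 2) + (x - y) * x₀ * (n / t)) : ℂ) *
      ((n : ℂ) / ((2 * (Real.pi : ℂ) * Complex.I) ^ 2 * (t : ℂ))) *
      (Complex.I * ∫ η : ℝ,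
        Complex.exp (((n / (2 * t) : ℝ) : ℂ) * (((m : ℂ) + (η : ℂ) * Complex.I) - x) ^ 2) *
        twoRectIntegral m e R b (fun w => 1 / (((m : ℂ) + (η : ℂ) * Complex.I) - w) *
          (nodePoly a ((m : ℂ) + (η : ℂ) * Complex.I) *
            (Complex.exp (-((n / (2 * t) : ℝ) : ℂ) * (w - y) ^ 2) / nodePoly a w)))) := by
  obtain ⟨q, hq, hqa⟩ := exists_nodePoly_sub a
  have hκ : 0 < (n : ℝ) / (2 * t) := by
    have : (0 : ℝ) < n := by exact_mod_cast Nat.pos_of_ne_zero hn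
    positivity
  set κ : ℝ := n / (2 * t) with hκdef
  set f : ℂ → ℂ := fun w => Complex.exp (-(κ : ℂ) * (w - y) ^ 2) with hfdef
  have hf : Differentiable ℂ f := by rw [hfdef]; fun_prop
  set E : ℂ → ℂ := fun z => Complex.exp ((κ : ℂ) * (z - x) ^ 2) with hEdef
  have hE : Differentiable ℂ E := by rw [hEdef]; fun_prop
  set c : ℕ → ℂ := fun k => twoRectIntegral m e R b (fun w => f w * q k w / nodePoly a w)
  set T : ℂ → ℂ := fun z => ∑ k ∈ Finset.range n, z ^ k * c k with hT
  have hTd : Differentiable ℂ T := by rw [hT]; fun_prop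
  have ha : ∀ j, (a j : ℂ) ∉ twoRectBoundary m e R b := fun j =>
    ofReal_notMem_twoRectBoundary he.le heR hb (hae j) (haR j)
  -- the integral over the rectangles
  have hmid : ∀ η : ℝ, twoRectIntegral m e R b (fun w => 1 / (((m : ℂ) + (η : ℂ) * Complex.I) - w) *
      (nodePoly a ((m : ℂ) + (η : ℂ) * Complex.I) * (f w / nodePoly a w))) =
      T ((m : ℂ) + (η : ℂ) * Complex.I) := by
    intro η
    have hz : (m : ℂ) + (η : ℂ) * Complex.I ∉ twoRectBoundary m e R b := by
      intro hz
      have := (mem_twoRectBoundary he.le heR hb.le hz).1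
      simp at this
      linarith
    rw [(twoRect_isCycle heR hb.le).cauchy_kernel ha hq hqa hf hz,
      twoRectIntegral_middle he heR hb (by simp), mul_zero, sub_zero]
  -- the integral over the original contour
  have hline : ∀ η : ℝ, |η| ≠ s → contourIntegral γ (fun w =>
      1 / (((x₀ : ℂ) + (η : ℂ) * Complex.I) - w) *
      (Complex.exp ((n : ℂ) / (2 * (t : ℂ)) *
          ((((x₀ : ℂ) + (η : ℂ) * Complex.I) - (x : ℂ)) ^ 2 + 2 * (t : ℂ) *
            logPotential (empiricalMeasure a) ((x₀ : ℂ) + (η : ℂ) * Complex.I))) /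
        Complex.exp ((n : ℂ) / (2 * (t : ℂ)) *
          ((w - (y : ℂ)) ^ 2 + 2 * (t : ℂ) * logPotential (empiricalMeasure a) w)))) =
      E ((x₀ : ℂ) + (η : ℂ) * Complex.I) * T ((x₀ : ℂ) + (η : ℂ) * Complex.I) -
        2 * Real.pi * Complex.I * (Ioc (-s) s).indicator (fun η : ℝ =>
          E ((x₀ : ℂ) + (η : ℂ) * Complex.I) * f ((x₀ : ℂ) + (η : ℂ) * Complex.I)) η := by
    intro η hη
    set z : ℂ := (x₀ : ℂ) + (η : ℂ) * Complex.I with hzdef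
    have hzre : z.re = x₀ := by simp [hzdef]
    have hzim : z.im = η := by simp [hzdef]
    have hza : ∀ j, z ≠ a j := fun j hj => hx₀ j (by rw [← hzre, hj, Complex.ofReal_re])
    have hzγ : z ∉ γ '' Icc 0 1 := by
      intro hz
      have hmem : z ∈ γ '' Icc 0 1 ∩ {z : ℂ | z.re = x₀} := ⟨hz, hzre⟩
      rw [h.inter_line] at hmem
      apply hη
      rw [← hzim]
      rcases hmem with hmem | hmem
      · rw [hmem]; simp [abs_of_pos h.s_pos]
      · rw [mem_singleton_iff.1 hmem]; simp [abs_of_pos h.s_pos]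
    have hcyc := h.isClosedContour.isCycle
    have hcongr : EqOn (fun w => 1 / (z - w) *
        (Complex.exp ((n : ℂ) / (2 * (t : ℂ)) * ((z - (x : ℂ)) ^ 2 + 2 * (t : ℂ) *
            logPotential (empiricalMeasure a) z)) /
        Complex.exp ((n : ℂ) / (2 * (t : ℂ)) *
          ((w - (y : ℂ)) ^ 2 + 2 * (t : ℂ) * logPotential (empiricalMeasure a) w))))
        (fun w => E z * (1 / (z - w) * (nodePoly a z * (f w / nodePoly a w)))) (γ '' Icc 0 1) := by
      intro w hw
      have hwa : ∀ j, w ≠ a j := fun j hj => h.off_points j (hj ▸ hw)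
      have hfw : f w = (Complex.exp ((κ : ℂ) * (w - y) ^ 2))⁻¹ := by
        simp only [hfdef]
        rw [← Complex.exp_neg, neg_mul]
      simp only [exp_phase hn a ht.ne' x hza, exp_phase hn a ht.ne' y hwa, hfw, hEdef]
      rw [← hκdef]
      field_simp
    rw [hcyc.congr hcongr, hcyc.const_mul, hcyc.cauchy_kernel h.off_points hq hqa hf hzγ]
    have hc : ∀ k, contourIntegral γ (fun w => f w * q k w / nodePoly a w) = c k := fun k =>
      h.integral_eq_twoRect he.le heR hb hae haR (hf.mul (hq k))
    simp only [hc]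
    rw [mul_sub]
    congr 1
    by_cases hηs : |η| < s
    · have hw := h.segment_inside η hηs
      rw [windingNumber, inv_mul_eq_one₀ Complex.two_pi_I_ne_zero] at hw
      obtain ⟨h1, h2⟩ := abs_lt.1 hηs
      rw [indicator_of_mem (show η ∈ Ioc (-s) s from ⟨h1, h2.le⟩), hzdef, ← hw]
      ring
    · have hs' : s < |η| := lt_of_le_of_ne (not_lt.1 hηs) (Ne.symm hη)
      rw [hzdef, h.integral_outside hs', indicator_of_notMem]
      · ring
      · rintro ⟨h1, h2⟩
        exact hs'.not_ge (abs_le.2 ⟨h1.le, h2⟩)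
  obtain ⟨C, hC⟩ := exists_gaussian_bound hκ x (max |x₀| |m|) n c
  have hκ2 : 0 < κ / 2 := by positivity
  have hint : Integrable fun η : ℝ =>
      E ((x₀ : ℂ) + (η : ℂ) * Complex.I) * T ((x₀ : ℂ) + (η : ℂ) * Complex.I) := by
    refine ((integrable_exp_neg_mul_sq hκ2).const_mul C).mono' ?_
      (Eventually.of_forall (hC x₀ (le_max_left _ _)))
    have h1 := hE.continuous
    have h2 := hTd.continuous
    exact (by fun_prop : Continuous fun η : ℝ => E ((x₀ : ℂ) + (η : ℂ) * Complex.I) *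
      T ((x₀ : ℂ) + (η : ℂ) * Complex.I)).aestronglyMeasurable
  have hint2 : Integrable ((Ioc (-s) s).indicator fun η : ℝ =>
      E ((x₀ : ℂ) + (η : ℂ) * Complex.I) * f ((x₀ : ℂ) + (η : ℂ) * Complex.I)) := by
    rw [integrable_indicator_iff measurableSet_Ioc]
    have h1 := hE.continuous
    have h2 := hf.continuous
    exact ((by fun_prop : Continuous fun η : ℝ => E ((x₀ : ℂ) + (η : ℂ) * Complex.I) *
      f ((x₀ : ℂ) + (η : ℂ) * Complex.I)).integrableOn_Icc).mono_set Ioc_subset_Icc_self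
  have hσabs : ∀ σ ∈ uIcc x₀ m, |σ| ≤ max |x₀| |m| := by
    intro σ hσ
    rcases mem_uIcc.1 hσ with h1 | h1
    · exact abs_le_max_abs_abs h1.1 h1.2
    · rw [max_comm]; exact abs_le_max_abs_abs h1.1 h1.2
  -- `T` is a polynomial whose coefficients are the same for both cycles, so moving the line from
  -- `x₀` to `m` crosses no pole.
  have hshift := integral_vertical_line_eq (f := fun z => E z * T z) (hE.mul hTd)
    (c₀ := x₀) (c₁ := m) hκ2 (fun σ hσ η => hC σ (hσabs σ hσ) η)
  have hdouble : doubleIntegral a t x₀ γ x y =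
      Complex.I * (∫ η : ℝ, E ((m : ℂ) + (η : ℂ) * Complex.I) *
        T ((m : ℂ) + (η : ℂ) * Complex.I)) +
      2 * Real.pi * ∫ η in (-s)..s,
        E ((x₀ : ℂ) + (η : ℂ) * Complex.I) * f ((x₀ : ℂ) + (η : ℂ) * Complex.I) := by
    rw [← hshift, intervalIntegral.integral_of_le (by linarith [h.s_pos]),
      ← integral_indicator measurableSet_Ioc, ← integral_const_mul, ← integral_const_mul,
      ← integral_add (hint.const_mul _) (hint2.const_mul _), doubleIntegral]
    refine integral_congr_ae ?_
    -- At these two heights `z` lies on `γ`, where the contour formula is not available.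
    have hae : ∀ᵐ η : ℝ, η ∉ ({s, -s} : Set ℝ) :=
      ((Set.finite_singleton (-s)).insert s).countable.ae_notMem volume
    filter_upwards [hae] with η hη
    have hηs : |η| ≠ s := by
      intro h0
      apply hη
      rcases abs_choice η with h1 | h1
      · left; rw [← h1, h0]
      · right; rw [mem_singleton_iff]; linarith
    rw [hline η hηs, mul_sub]
    linear_combination (-2 * Real.pi * (Ioc (-s) s).indicator (fun η : ℝ =>
      E ((x₀ : ℂ) + (η : ℂ) * Complex.I) * f ((x₀ : ℂ) + (η : ℂ) * Complex.I)) η) * Complex.I_sq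
  have hright : (∫ η : ℝ,
        Complex.exp ((κ : ℂ) * (((m : ℂ) + (η : ℂ) * Complex.I) - x) ^ 2) *
        twoRectIntegral m e R b (fun w => 1 / (((m : ℂ) + (η : ℂ) * Complex.I) - w) *
          (nodePoly a ((m : ℂ) + (η : ℂ) * Complex.I) *
            (Complex.exp (-(κ : ℂ) * (w - y) ^ 2) / nodePoly a w)))) =
      ∫ η : ℝ, E ((m : ℂ) + (η : ℂ) * Complex.I) * T ((m : ℂ) + (η : ℂ) * Complex.I) :=
    integral_congr_ae (Eventually.of_forall fun η =>
      congrArg (E ((m : ℂ) + (η : ℂ) * Complex.I) * ·) (hmid η))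
  have hcancel : (Real.exp (-κ * (x ^ 2 - y ^ 2) + (x - y) * x₀ * (n / t)) : ℂ) *
      ((n : ℂ) / ((2 * (Real.pi : ℂ) * Complex.I) ^ 2 * (t : ℂ))) *
      (2 * Real.pi * ∫ η in (-s)..s,
        E ((x₀ : ℂ) + (η : ℂ) * Complex.I) * f ((x₀ : ℂ) + (η : ℂ) * Complex.I)) +
      (sineTerm n t s x y : ℂ) = 0 := sineTerm_cancel n hn ht x₀ s x y
  rw [hright, kernel, hdouble, mul_add, add_assoc, hcancel, add_zero]

end DysonGap

end

/-! ### Exponential smallness of the kernel -/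

noncomputable section

namespace DysonGap

theorem norm_rectIntegral_le {l r b M : ℝ} (hl : l ≤ r) (hb : 0 ≤ b) {f : ℂ → ℂ}
    (hf : ∀ w ∈ rectBoundary l r b, ‖f w‖ ≤ M) :
    ‖rectIntegral l r b f‖ ≤ M * (2 * (r - l) + 4 * b) := by
  have hb' : -b ≤ b := by linarith
  have h1 : ‖∫ x in l..r, f ((x : ℂ) + (-b : ℝ) * Complex.I)‖ ≤ M * (r - l) := by
    rw [← abs_of_nonneg (sub_nonneg.2 hl)]
    refine intervalIntegral.norm_integral_le_of_norm_le_const fun x hx => hf _ (bottom_mem ?_)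
    rw [uIoc_of_le hl] at hx; exact Ioc_subset_Icc_self hx
  have h2 : ‖∫ x in l..r, f ((x : ℂ) + (b : ℝ) * Complex.I)‖ ≤ M * (r - l) := by
    rw [← abs_of_nonneg (sub_nonneg.2 hl)]
    refine intervalIntegral.norm_integral_le_of_norm_le_const fun x hx => hf _ (top_mem ?_)
    rw [uIoc_of_le hl] at hx; exact Ioc_subset_Icc_self hx
  have h3 : ‖∫ y in (-b)..b, f ((r : ℂ) + (y : ℝ) * Complex.I)‖ ≤ M * (b - -b) := by
    rw [← abs_of_nonneg (sub_nonneg.2 hb')]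
    refine intervalIntegral.norm_integral_le_of_norm_le_const fun x hx => hf _ (right_mem ?_)
    rw [uIoc_of_le hb'] at hx; exact Ioc_subset_Icc_self hx
  have h4 : ‖∫ y in (-b)..b, f ((l : ℂ) + (y : ℝ) * Complex.I)‖ ≤ M * (b - -b) := by
    rw [← abs_of_nonneg (sub_nonneg.2 hb')]
    refine intervalIntegral.norm_integral_le_of_norm_le_const fun x hx => hf _ (left_mem ?_)
    rw [uIoc_of_le hb'] at hx; exact Ioc_subset_Icc_self hx
  unfold rectIntegral
  refine (norm_add_le _ _).trans ((add_le_add (norm_sub_le _ _) (norm_sub_le _ _)).trans ?_)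
  rw [norm_mul, norm_mul, Complex.norm_I]
  linarith

/-- Factor by factor, `|z - a j| ≤ |w - a j| (1 + |z - w| / c)`, and `1 + u ≤ exp u`. -/
theorem norm_nodePoly_le {n : ℕ} {a : Fin n → ℝ} {z w : ℂ} {c : ℝ} (hc : 0 < c)
    (hw : ∀ j, c ≤ ‖w - a j‖) :
    ‖nodePoly a z‖ ≤ ‖nodePoly a w‖ * Real.exp (n * (‖z - w‖ / c)) := by
  unfold nodePoly
  rw [norm_prod, norm_prod]
  calc ∏ j, ‖z - a j‖ ≤ ∏ j, (‖w - a j‖ * Real.exp (‖z - w‖ / c)) := by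
        refine Finset.prod_le_prod (fun _ _ => norm_nonneg _) fun j _ => ?_
        have h1 : ‖z - a j‖ ≤ ‖z - w‖ + ‖w - a j‖ := norm_sub_le_norm_sub_add_norm_sub _ _ _
        have h2 := Real.add_one_le_exp (‖z - w‖ / c)
        have h3 : ‖z - w‖ ≤ ‖w - a j‖ * (‖z - w‖ / c) := by
          calc ‖z - w‖ = c * (‖z - w‖ / c) := by field_simp
            _ ≤ _ := by gcongr; exact hw j
        nlinarith [norm_nonneg (w - a j)]
    _ = _ := by
        rw [Finset.prod_mul_distrib, Finset.prod_const, Finset.card_univ, Fintype.card_fin,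
          ← Real.exp_nat_mul]

variable {m d R : ℝ}

/-- Horizontal sides have height `d / 4`, inner sides lie `d / 2` closer to `m` than any node, and
outer sides lie at least `1 ≥ d / 4` beyond. -/
theorem le_norm_sub_node (hd : 0 < d) (hd1 : d ≤ 1) {α : ℝ} (hα : d < |α - m|)
    (hαR : |α - m| ≤ R - 1) {w : ℂ} (hw : w ∈ twoRectBoundary m (d / 2) R (d / 4)) :
    d / 4 ≤ ‖w - α‖ := by
  obtain ⟨-, -, h⟩ := mem_twoRectBoundary (by linarith) (by linarith) (by linarith) hw
  have him : |w.im| ≤ ‖w - α‖ := by simpa using Complex.abs_im_le_norm (w - α)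
  have hre : |w.re - α| ≤ ‖w - α‖ := by simpa using Complex.abs_re_le_norm (w - α)
  have h1 : |w.re - m| ≤ |w.re - α| + |α - m| := abs_sub_le _ _ _
  have h2 : |α - m| ≤ |w.re - α| + |w.re - m| := by
    rw [abs_sub_comm w.re α]; exact abs_sub_le _ _ _
  rcases h with h | h | h <;> linarith

/-- The bound on the exponent of the integrand after deformation. -/
theorem exponent_le {k t n η x y x₀ wr wi : ℝ} (hk : 0 ≤ k) (hd : 0 < d) (hn : n = 2 * k * t)
    (ht : t ≤ d ^ 2 / 1000) (hx : |x - m| ≤ d / 1000) (hy : |y - m| ≤ d / 1000)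
    (hx₀ : |x₀ - m| ≤ d) (hwr : d / 2 ≤ |wr - m|) (hwi : |wi| ≤ d / 4) :
    (-k * (x ^ 2 - y ^ 2) + (x - y) * x₀ * (2 * k)) + k * ((m - x) ^ 2 - η ^ 2) +
      (-k) * ((wr - y) ^ 2 - wi ^ 2) + n * ((|η| + |wr - m| + d / 4) / (d / 4)) ≤
      -(k / 2) * η ^ 2 + -(k * d ^ 2 / 8) := by
  set ρ := |wr - m| with hρ
  have h1 : -(x ^ 2 - y ^ 2) + (x - y) * x₀ * 2 ≤ 5 / 1000 * d ^ 2 := by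
    have e : -(x ^ 2 - y ^ 2) + (x - y) * x₀ * 2 =
        -((x - m) - (y - m)) * ((x - m) + (y - m) - 2 * (x₀ - m)) := by ring
    rw [e]
    refine (le_abs_self _).trans ?_
    rw [abs_mul, abs_neg]
    have h2 : |(x - m) - (y - m)| ≤ 2 / 1000 * d := (abs_sub _ _).trans (by linarith)
    have h3 : |(x - m) + (y - m) - 2 * (x₀ - m)| ≤ 2002 / 1000 * d := by
      refine (abs_sub _ _).trans ?_
      rw [abs_mul, abs_two]
      have := abs_add_le (x - m) (y - m)
      linarith
    calc _ ≤ (2 / 1000 * d) * (2002 / 1000 * d) := by gcongr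
      _ ≤ _ := by nlinarith [sq_nonneg d]
  have h2 : (m - x) ^ 2 ≤ 1 / 1000 * d ^ 2 := by
    rw [← sq_abs, abs_sub_comm]
    calc |x - m| ^ 2 ≤ (d / 1000) ^ 2 := by gcongr
      _ ≤ _ := by nlinarith [sq_nonneg d]
  -- Here `ρ ≥ d / 2` gives `|y - m| ≤ 0.002 ρ` and `|wi| ≤ ρ / 2`, and `0.998² - 1/4 > 0.74`.
  have h3 : 74 / 100 * ρ ^ 2 ≤ (wr - y) ^ 2 - wi ^ 2 := by
    have h4 : 998 / 1000 * ρ ≤ |wr - y| := by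
      have h5 : ρ ≤ |wr - y| + |y - m| := abs_sub_le _ _ _
      linarith
    have h6 : wi ^ 2 ≤ ρ ^ 2 / 4 := by
      rw [← sq_abs]
      calc |wi| ^ 2 ≤ (ρ / 2) ^ 2 := by gcongr; linarith
        _ = _ := by ring
    have h7 : (998 / 1000 * ρ) ^ 2 ≤ (wr - y) ^ 2 := by
      rw [← sq_abs (wr - y)]
      have : 0 ≤ ρ := abs_nonneg _
      gcongr
    nlinarith [sq_nonneg ρ]
  have h4 : n * ((|η| + ρ + d / 4) / (d / 4)) ≤ k * (8 / 1000 * (d * |η|) + 12 / 1000 * (d * ρ)) := by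
    have h5 : n * ((|η| + ρ + d / 4) / (d / 4)) = k * ((8 * t / d) * (|η| + ρ + d / 4)) := by
      rw [hn]; field_simp; ring
    rw [h5]
    refine mul_le_mul_of_nonneg_left ?_ hk
    have h6 : 8 * t / d ≤ 8 / 1000 * d := by
      rw [div_le_iff₀ hd]; nlinarith
    have h7 : 0 ≤ |η| := abs_nonneg _
    calc (8 * t / d) * (|η| + ρ + d / 4) ≤ (8 / 1000 * d) * (|η| + ρ + ρ / 2) :=
          mul_le_mul h6 (by linarith) (by positivity) (by positivity)
      _ = _ := by ring
  have h5 : d * |η| ≤ (d ^ 2 + η ^ 2) / 2 := by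
    nlinarith [sq_nonneg (d - |η|), sq_abs η]
  have h6 : d * ρ ≤ 2 * ρ ^ 2 := by nlinarith
  have h7 : d ^ 2 / 4 ≤ ρ ^ 2 := by nlinarith
  -- All errors total at most `0.01 d² + 0.004 η² + 0.024 ρ²`; the main terms `-η² - 0.74 ρ²` with
  -- `ρ² ≥ d² / 4` dominate them.
  have h8 : (-(x ^ 2 - y ^ 2) + (x - y) * x₀ * 2) + ((m - x) ^ 2 - η ^ 2) -
      ((wr - y) ^ 2 - wi ^ 2) + (8 / 1000 * (d * |η|) + 12 / 1000 * (d * ρ)) ≤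
      -(1 / 2) * η ^ 2 - d ^ 2 / 8 := by nlinarith [sq_nonneg η]
  have h9 := mul_le_mul_of_nonneg_left h8 hk
  linarith

/-- Exponential smallness of the kernel in a gap of the starting points. -/
theorem norm_kernel_le {n : ℕ} (hn : n ≠ 0) {a : Fin n → ℝ} {t : ℝ} (ht : 0 < t)
    {x₀ s : ℝ} {γ : ℝ → ℂ} (h : IsAdmissibleContour a x₀ s γ) (hd : 0 < d) (hd1 : d ≤ 1)
    (hR : d ≤ R) (had : ∀ j, d < |a j - m|) (haR : ∀ j, |a j - m| ≤ R - 1)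
    (htd : t ≤ d ^ 2 / 1000) {x y : ℝ} (hx : |x - m| ≤ d / 1000) (hy : |y - m| ≤ d / 1000)
    (hx₀ : |x₀ - m| ≤ d) :
    ‖kernel a t x₀ s γ x y‖ ≤
      24 * R * (n / (2 * t)) / d * Real.exp (-(n / (2 * t) * d ^ 2 / 8)) := by
  have hn1 : (1 : ℝ) ≤ n := by exact_mod_cast Nat.one_le_iff_ne_zero.2 hn
  rw [kernel_eq_twoRect (m := m) (e := d / 2) (R := R) (b := d / 4) hn ht h
    (fun j hj => (had j).not_ge (hj ▸ hx₀)) (by linarith) (by linarith) (by linarith)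
    (fun j => by linarith [had j]) (fun j => by linarith [haR j])]
  set k : ℝ := n / (2 * t) with hk
  have hnk : (n : ℝ) = 2 * k * t := by rw [hk]; field_simp
  have hnt : (n : ℝ) / t = 2 * k := by rw [hk]; field_simp
  have hk1 : 1 ≤ k := by
    rw [hk, le_div_iff₀ (by positivity)]
    nlinarith
  have hk0 : 0 < k := by linarith
  set A : ℝ := Real.exp (-k * (x ^ 2 - y ^ 2) + (x - y) * x₀ * (n / t)) with hA
  have hA0 : 0 < A := Real.exp_pos _
  -- The prefactor `A` enters the estimate as `A⁻¹`, since only its product with the Gaussians is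
  -- under control.
  have hpt : ∀ η : ℝ, ∀ w ∈ twoRectBoundary m (d / 2) R (d / 4),
      ‖Complex.exp ((k : ℂ) * (((m : ℂ) + (η : ℂ) * Complex.I) - x) ^ 2)‖ *
      ‖1 / (((m : ℂ) + (η : ℂ) * Complex.I) - w) *
        (nodePoly a ((m : ℂ) + (η : ℂ) * Complex.I) *
          (Complex.exp (-(k : ℂ) * (w - y) ^ 2) / nodePoly a w))‖ ≤
      A⁻¹ * (2 / d * Real.exp (-(k * d ^ 2 / 8)) * Real.exp (-(k / 2) * η ^ 2)) := by
    intro η w hw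
    set z : ℂ := (m : ℂ) + (η : ℂ) * Complex.I with hz
    have hzre : z.re = m := by simp [hz]
    have hzim : z.im = η := by simp [hz]
    obtain ⟨hw1, hw2, -⟩ := mem_twoRectBoundary (by linarith) (by linarith) (by linarith) hw
    have hdist : ∀ j, d / 4 ≤ ‖w - a j‖ := fun j =>
      le_norm_sub_node hd hd1 (had j) (haR j) hw
    have hN0 : 0 < ‖nodePoly a w‖ := norm_pos_iff.2 <| nodePoly_ne_zero fun j hj => by
      have := hdist j
      rw [hj, sub_self, norm_zero] at this
      linarith
    have hzw : ‖z - w‖ ≤ |η| + |w.re - m| + d / 4 := by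
      refine (Complex.norm_le_abs_re_add_abs_im _).trans ?_
      rw [Complex.sub_re, Complex.sub_im, hzre, hzim, abs_sub_comm m]
      have := abs_sub η w.im
      linarith
    have hzw' : d / 2 ≤ ‖z - w‖ := by
      refine hw1.trans ?_
      have := Complex.abs_re_le_norm (z - w)
      rwa [Complex.sub_re, hzre, abs_sub_comm] at this
    have h1 : ‖1 / (z - w)‖ ≤ 2 / d := by
      rw [norm_div, norm_one, div_le_div_iff₀ (by linarith) hd]
      linarith
    have h2 : ‖nodePoly a z‖ / ‖nodePoly a w‖ ≤
        Real.exp (n * ((|η| + |w.re - m| + d / 4) / (d / 4))) := by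
      rw [div_le_iff₀ hN0, mul_comm]
      refine (norm_nodePoly_le (by linarith) hdist).trans ?_
      gcongr
    have h3 : ‖Complex.exp (-(k : ℂ) * (w - y) ^ 2)‖ =
        Real.exp (-k * ((w.re - y) ^ 2 - w.im ^ 2)) := by
      have := norm_cexp_mul_sub_sq (-k) y w
      rwa [Complex.ofReal_neg] at this
    rw [norm_cexp_mul_sub_sq, hzre, hzim, norm_mul, norm_mul, norm_div (Complex.exp _), h3,
      le_inv_mul_iff₀ hA0]
    calc A * (Real.exp (k * ((m - x) ^ 2 - η ^ 2)) * (‖1 / (z - w)‖ * (‖nodePoly a z‖ *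
          (Real.exp (-k * ((w.re - y) ^ 2 - w.im ^ 2)) / ‖nodePoly a w‖))))
        = ‖1 / (z - w)‖ * (A * Real.exp (k * ((m - x) ^ 2 - η ^ 2)) *
          Real.exp (-k * ((w.re - y) ^ 2 - w.im ^ 2)) *
          (‖nodePoly a z‖ / ‖nodePoly a w‖)) := by ring
      _ ≤ 2 / d * (A * Real.exp (k * ((m - x) ^ 2 - η ^ 2)) *
          Real.exp (-k * ((w.re - y) ^ 2 - w.im ^ 2)) *
          Real.exp (n * ((|η| + |w.re - m| + d / 4) / (d / 4)))) := by gcongr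
      _ ≤ 2 / d * (Real.exp (-(k / 2) * η ^ 2 + -(k * d ^ 2 / 8))) := by
          rw [hA, ← Real.exp_add, ← Real.exp_add, ← Real.exp_add, hnt]
          exact mul_le_mul_of_nonneg_left (Real.exp_le_exp.2
            (exponent_le hk0.le hd hnk htd hx hy hx₀ hw1 hw2)) (by positivity)
      _ = _ := by rw [Real.exp_add]; ring
  -- Each rectangle contributes length at most `2 R`, so `8 R / d` is the total `4 R` times the
  -- bound `2 / d` for the Cauchy factor.
  have hbound : ∀ η : ℝ,
      ‖Complex.exp ((k : ℂ) * (((m : ℂ) + (η : ℂ) * Complex.I) - x) ^ 2) *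
        twoRectIntegral m (d / 2) R (d / 4)
          (fun w => 1 / (((m : ℂ) + (η : ℂ) * Complex.I) - w) *
            (nodePoly a ((m : ℂ) + (η : ℂ) * Complex.I) *
              (Complex.exp (-(k : ℂ) * (w - y) ^ 2) / nodePoly a w)))‖ ≤
      A⁻¹ * (8 * R / d * Real.exp (-(k * d ^ 2 / 8))) * Real.exp (-(k / 2) * η ^ 2) := by
    intro η
    have hE : 0 < ‖Complex.exp ((k : ℂ) * (((m : ℂ) + (η : ℂ) * Complex.I) - x) ^ 2)‖ :=
      norm_pos_iff.2 (Complex.exp_ne_zero _)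
    set B := A⁻¹ * (2 / d * Real.exp (-(k * d ^ 2 / 8)) * Real.exp (-(k / 2) * η ^ 2)) with hB
    have hM : ∀ w ∈ twoRectBoundary m (d / 2) R (d / 4),
        ‖1 / (((m : ℂ) + (η : ℂ) * Complex.I) - w) *
        (nodePoly a ((m : ℂ) + (η : ℂ) * Complex.I) *
          (Complex.exp (-(k : ℂ) * (w - y) ^ 2) / nodePoly a w))‖ ≤
        B / ‖Complex.exp ((k : ℂ) * (((m : ℂ) + (η : ℂ) * Complex.I) - x) ^ 2)‖ := by
      intro w hw
      rw [le_div_iff₀' hE]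
      exact hpt η w hw
    have hΛ := (norm_add_le _ _).trans (add_le_add
      (norm_rectIntegral_le (l := m - R) (r := m - d / 2) (b := d / 4) (by linarith)
        (by linarith) fun w hw => hM w (Or.inl hw))
      (norm_rectIntegral_le (l := m + d / 2) (r := m + R) (b := d / 4) (by linarith)
        (by linarith) fun w hw => hM w (Or.inr hw)))
    rw [norm_mul, twoRectIntegral]
    refine (mul_le_mul_of_nonneg_left hΛ hE.le).trans (le_of_eq ?_)
    rw [hB]
    field_simp
    ring
  have hk2 : 0 < k / 2 := by linarith
  have hI := norm_integral_le_of_norm_le ((integrable_exp_neg_mul_sq hk2).const_mul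
    (A⁻¹ * (8 * R / d * Real.exp (-(k * d ^ 2 / 8))))) (Eventually.of_forall hbound)
  rw [integral_const_mul, integral_gaussian] at hI
  have hsq : √(Real.pi / (k / 2)) ≤ 3 := by
    rw [Real.sqrt_le_left (by norm_num), div_le_iff₀ hk2]
    nlinarith [Real.pi_lt_d2]
  have hc : ‖(n : ℂ) / ((2 * (Real.pi : ℂ) * Complex.I) ^ 2 * (t : ℂ))‖ ≤ k := by
    have e : ‖(n : ℂ) / ((2 * (Real.pi : ℂ) * Complex.I) ^ 2 * (t : ℂ))‖ =
        n / ((2 * Real.pi) ^ 2 * t) := by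
      simp [abs_of_pos Real.pi_pos, abs_of_pos ht]
    rw [e, hk]
    gcongr
    nlinarith [Real.pi_gt_three]
  have hR0 : 0 < R := by linarith
  rw [norm_mul, norm_mul, norm_mul, Complex.norm_I, one_mul, Complex.norm_real, Real.norm_eq_abs,
    abs_of_pos hA0]
  calc _ ≤ A * k * (A⁻¹ * (8 * R / d * Real.exp (-(k * d ^ 2 / 8))) * 3) := by
        gcongr
        exact hI.trans (by gcongr)
    _ = _ := by field_simp; ring

end DysonGap

end

/-! ### Displacement of the path -/

noncomputable section

namespace DysonGap

/-- This is `2 √t |v| ≤ v² + t`. It trades the kernel of the displacement for the one that the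
definition of `yFun` controls. -/
theorem amgm_div {t v y : ℝ} (ht : 0 < t) :
    t * (|v| / (v ^ 2 + y ^ 2)) ≤ √t / 2 + t * √t / 2 * (1 / (v ^ 2 + y ^ 2)) := by
  rcases eq_or_ne v 0 with rfl | hv
  · simp; positivity
  have hD : 0 < v ^ 2 + y ^ 2 := by positivity
  have h1 : t * |v| * 2 ≤ √t * (v ^ 2 + y ^ 2) + t * √t := by
    have hs := Real.sq_sqrt ht.le
    have hs0 := Real.sqrt_pos.2 ht
    have h2 : 0 ≤ √t * (|v| - √t) ^ 2 := by positivity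
    have h3 : √t * (|v| - √t) ^ 2 = √t * |v| ^ 2 - 2 * |v| * √t ^ 2 + √t * √t ^ 2 := by ring
    rw [h3, hs, sq_abs] at h2
    nlinarith [mul_nonneg hs0.le (sq_nonneg y)]
  have h4 : √t / 2 + t * √t / 2 * (1 / (v ^ 2 + y ^ 2)) =
      (√t * (v ^ 2 + y ^ 2) + t * √t) / 2 / (v ^ 2 + y ^ 2) := by field_simp
  rw [h4, ← mul_div_assoc]
  gcongr
  linarith

theorem integrable_one_div (μ : Measure ℝ) [IsProbabilityMeasure μ] (x : ℝ) {y : ℝ} (hy : 0 < y) :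
    Integrable (fun s => 1 / ((x - s) ^ 2 + y ^ 2)) μ := by
  refine Integrable.of_bound (C := 1 / y ^ 2) ?_ (Eventually.of_forall fun s => ?_)
  · exact (Continuous.div continuous_const (by fun_prop) fun s => by positivity).aestronglyMeasurable
  · rw [Real.norm_of_nonneg (by positivity)]
    gcongr
    nlinarith [sq_nonneg (x - s)]

/-- The integral decreases in `y`, so the set under the infimum is upward closed; it contains `√t`.
-/
theorem integral_le_of_yFun_lt (μ : Measure ℝ) [IsProbabilityMeasure μ] {t x y : ℝ} (ht : 0 < t)
    (hy : yFun μ t x < y) : 0 < y ∧ ∫ s, 1 / ((x - s) ^ 2 + y ^ 2) ∂μ ≤ 1 / t := by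
  have hne : {y : ℝ | 0 < y ∧ ∫ s, 1 / ((x - s) ^ 2 + y ^ 2) ∂μ ≤ 1 / t}.Nonempty := by
    refine ⟨√t, Real.sqrt_pos.2 ht, ?_⟩
    refine (integral_mono (integrable_one_div μ x (Real.sqrt_pos.2 ht)) (integrable_const (1 / t))
      fun s => ?_).trans (by simp)
    rw [Real.sq_sqrt ht.le]
    simp only
    gcongr
    nlinarith [sq_nonneg (x - s)]
  obtain ⟨y', ⟨hy'0, hy'⟩, hlt⟩ := exists_lt_of_csInf_lt hne hy
  have hy0 : 0 < y := hy'0.trans hlt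
  refine ⟨hy0, le_trans ?_ hy'⟩
  refine integral_mono (integrable_one_div μ x hy0) (integrable_one_div μ x hy'0) fun s => ?_
  simp only
  gcongr

/-- The infimum may be zero or unattained, so the bound is proved at `y + 1 / (k + 1)` and passed to
the limit by Fatou. AM-GM gives `√t / 2` twice. -/
theorem lintegral_yFun_le (μ : Measure ℝ) [IsProbabilityMeasure μ] {t : ℝ} (ht : 0 < t) (x : ℝ) :
    ∫⁻ s, ENNReal.ofReal (t * (|x - s| / ((x - s) ^ 2 + yFun μ t x ^ 2))) ∂μ ≤
      ENNReal.ofReal √t := by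
  set y := yFun μ t x with hy
  have hy_lim : Tendsto (fun k : ℕ => y + 1 / ((k : ℝ) + 1)) atTop (𝓝 y) := by
    simpa using tendsto_one_div_add_atTop_nhds_zero_nat.const_add y
  have hlim : ∀ s, Tendsto (fun k : ℕ => ENNReal.ofReal
      (t * (|x - s| / ((x - s) ^ 2 + (y + 1 / ((k : ℝ) + 1)) ^ 2)))) atTop
      (𝓝 (ENNReal.ofReal (t * (|x - s| / ((x - s) ^ 2 + y ^ 2))))) := by
    intro s
    refine ENNReal.tendsto_ofReal ?_
    rcases eq_or_ne (x - s) 0 with h0 | h0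
    · simp [h0]
    · have hD : (x - s) ^ 2 + y ^ 2 ≠ 0 :=
        (add_pos_of_pos_of_nonneg (even_two.pow_pos h0) (sq_nonneg y)).ne'
      exact (tendsto_const_nhds.div ((hy_lim.pow 2).const_add _) hD).const_mul t
  have hle : ∀ k : ℕ, ∫⁻ s, ENNReal.ofReal
      (t * (|x - s| / ((x - s) ^ 2 + (y + 1 / ((k : ℝ) + 1)) ^ 2))) ∂μ ≤ ENNReal.ofReal √t := by
    intro k
    have hk : y < y + 1 / ((k : ℝ) + 1) := by
      have : (0 : ℝ) < 1 / ((k : ℝ) + 1) := by positivity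
      linarith
    obtain ⟨hk0, hk1⟩ := integral_le_of_yFun_lt μ ht hk
    have hint := (integrable_one_div μ x hk0).const_mul (t * √t / 2)
    have hsum : Integrable (fun s => √t / 2 + t * √t / 2 *
        (1 / ((x - s) ^ 2 + (y + 1 / ((k : ℝ) + 1)) ^ 2))) μ := (integrable_const _).add hint
    calc _ ≤ ∫⁻ s, ENNReal.ofReal (√t / 2 + t * √t / 2 *
          (1 / ((x - s) ^ 2 + (y + 1 / ((k : ℝ) + 1)) ^ 2))) ∂μ :=
          lintegral_mono fun s => ENNReal.ofReal_le_ofReal (amgm_div ht)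
      _ = ENNReal.ofReal (∫ s, (√t / 2 + t * √t / 2 *
          (1 / ((x - s) ^ 2 + (y + 1 / ((k : ℝ) + 1)) ^ 2))) ∂μ) :=
          (ofReal_integral_eq_lintegral_ofReal hsum
            (Eventually.of_forall fun s => by positivity)).symm
      _ ≤ _ := by
          refine ENNReal.ofReal_le_ofReal ?_
          rw [integral_add (integrable_const _) hint, integral_const_mul]
          have h1 : t * √t / 2 * ∫ s, 1 / ((x - s) ^ 2 + (y + 1 / ((k : ℝ) + 1)) ^ 2) ∂μ ≤
              t * √t / 2 * (1 / t) := by gcongr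
          have h2 : t * √t / 2 * (1 / t) = √t / 2 := by field_simp
          simp only [integral_const, probReal_univ, one_smul]
          linarith
  calc _ = ∫⁻ s, liminf (fun k : ℕ => ENNReal.ofReal
        (t * (|x - s| / ((x - s) ^ 2 + (y + 1 / ((k : ℝ) + 1)) ^ 2)))) atTop ∂μ :=
        lintegral_congr fun s => (hlim s).liminf_eq.symm
    _ ≤ liminf (fun k : ℕ => ∫⁻ s, ENNReal.ofReal
        (t * (|x - s| / ((x - s) ^ 2 + (y + 1 / ((k : ℝ) + 1)) ^ 2))) ∂μ) atTop :=
        lintegral_liminf_le fun k => by fun_prop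
    _ ≤ _ := liminf_le_of_frequently_le' (Frequently.of_forall hle)

/-- The displacement of the path is at most `√t`. -/
theorem abs_path_sub_le {μ : Measure ℝ} [IsProbabilityMeasure μ] {ψ : ℝ → ℝ} (hψ : Measurable ψ)
    (hψ0 : ∀ u, 0 ≤ ψ u) (hμ : μ = volume.withDensity fun u => ENNReal.ofReal (ψ u))
    {t : ℝ} (ht : 0 < t) (x : ℝ) : |path μ ψ t x - x| ≤ √t := by
  have h1 := lintegral_yFun_le μ ht x
  rw [path, add_sub_cancel_left, ← integral_const_mul, ← Real.norm_eq_abs,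
    ← ENNReal.ofReal_le_ofReal_iff (Real.sqrt_nonneg t), ofReal_norm]
  refine (enorm_integral_le_lintegral_enorm _).trans (le_trans (le_of_eq ?_) h1)
  set y := yFun μ t x
  rw [hμ, lintegral_withDensity_eq_lintegral_mul _ (by fun_prop) (by fun_prop)]
  refine lintegral_congr fun u => ?_
  rw [Pi.mul_apply, ← ENNReal.ofReal_mul (hψ0 u), ← ofReal_norm, Real.norm_eq_abs, abs_mul,
    abs_div, abs_mul, abs_of_pos ht, abs_of_nonneg (hψ0 u),
    abs_of_nonneg (by positivity : 0 ≤ (x - u) ^ 2 + y ^ 2)]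
  congr 1
  ring

end DysonGap

end

/-! ### Conclusion: matching the scales -/

theorem theorem1p4
    (a : (n : ℕ) → Fin n → ℝ) (μ : Measure ℝ) (ψ : ℝ → ℝ)
    (hconv : DysonGap.ConvergesWeaklyToDensity a μ ψ)
    (hcpt : DysonGap.ContainedInCompact a)
    (xs : ℝ) (δ ε t : ℕ → ℝ)
    (hδ_pos : ∀ n, 0 < δ n)
    (hδ_lim : Tendsto δ atTop (𝓝 0))
    (hnδ : Tendsto (fun n : ℕ => (n : ℝ) * δ n ^ 2) atTop atTop)
    (hgap : ∀ n, ∀ j, a n j ∉ Icc (xs - δ n) (xs + δ n))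
    (hε : ε =o[atTop] δ)
    (ht_pos : ∀ n, 0 < t n)
    (ht : t =o[atTop] (fun n => δ n ^ 2)) :
    ∀ C : Set (ℝ × ℝ), IsCompact C → ∀ r : ℝ, 0 < r →
      ∀ᶠ n : ℕ in atTop, ∀ u v : ℝ, (u, v) ∈ C →
        ∀ x₀ ∈ Icc (xs - δ n) (xs + δ n), ∀ (s : ℝ) (γ : ℝ → ℂ),
          DysonGap.IsAdmissibleContour (a n) x₀ s γ →
            ‖(ε n : ℂ) * DysonGap.kernel (a n) (t n) x₀ s γ
                (DysonGap.path μ ψ (t n) xs + ε n * u)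
                (DysonGap.path μ ψ (t n) xs + ε n * v)‖ < r := by
  intro C hC r hr
  have hprob := hconv.isProbabilityMeasure
  obtain ⟨S, hS, haS⟩ := hcpt
  obtain ⟨B, hB⟩ := hS.isBounded.subset_closedBall xs
  obtain ⟨M, hM⟩ := hC.isBounded.subset_closedBall (0 : ℝ × ℝ)
  set B' : ℝ := max B 0
  set M' : ℝ := max M 0
  have hB' : ∀ n j, |a n j - xs| ≤ B' + 1 - 1 := fun n j => by
    have h1 := hB (haS n j)
    rw [Metric.mem_closedBall, Real.dist_eq] at h1
    linarith [le_max_left B 0]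
  have hM' : ∀ u v : ℝ, (u, v) ∈ C → |u| ≤ M' ∧ |v| ≤ M' := fun u v huv => by
    have h1 := hM huv
    rw [mem_closedBall_zero_iff, Prod.norm_def, max_le_iff] at h1
    exact ⟨h1.1.trans (le_max_left _ _), h1.2.trans (le_max_left _ _)⟩
  have hB0 : 0 ≤ B' := le_max_right _ _
  have hM0 : 0 ≤ M' := le_max_right _ _
  -- the final bound tends to zero
  have hlim : Tendsto (fun X : ℝ => 24 * (B' + 1) * (X ^ 2 * Real.exp (-(X / 8)))) atTop
      (𝓝 0) := by
    have h1 := ((Real.tendsto_pow_mul_exp_neg_atTop_nhds_zero 2).comp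
      (tendsto_id.atTop_div_const (by norm_num : (0 : ℝ) < 8))).const_mul (24 * (B' + 1) * 64)
    rw [mul_zero] at h1
    refine h1.congr fun X => ?_
    simp only [Function.comp, id]
    ring
  obtain ⟨X₀, hX₀⟩ := eventually_atTop.1 (hlim.eventually (gt_mem_nhds hr))
  -- The allowance `δ / 1000` is split evenly between `ε u` and the displacement `√t`; hence `2000`,
  -- and `4000000 = 2000²` for `t`.
  have hε1 := hε.bound (show (0 : ℝ) < 1 / (2000 * (M' + 1)) by positivity)
  have ht1 := ht.bound (show (0 : ℝ) < 1 / 4000000 by norm_num)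
  filter_upwards [hε1, ht1, hδ_lim.eventually (ge_mem_nhds zero_lt_one),
    hnδ.eventually_ge_atTop 1, eventually_ge_atTop 1,
    tendsto_natCast_atTop_atTop.eventually_ge_atTop X₀] with n hεn htn hδ1 hnδ1 hn1 hnX
  intro u v huv x₀ hx₀ s γ h
  obtain ⟨hu, hv⟩ := hM' u v huv
  have hδ0 := hδ_pos n
  have ht0 := ht_pos n
  rw [Real.norm_of_nonneg (hδ_pos n).le, Real.norm_eq_abs] at hεn
  rw [Real.norm_of_nonneg (ht_pos n).le, Real.norm_of_nonneg (sq_nonneg _)] at htn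
  have hεM : |ε n| * (M' + 1) ≤ δ n / 2000 := by
    calc |ε n| * (M' + 1) ≤ (1 / (2000 * (M' + 1)) * δ n) * (M' + 1) := by gcongr
      _ = δ n / 2000 := by field_simp
  have hεδ : |ε n| ≤ δ n := by nlinarith [abs_nonneg (ε n)]
  have hsqrt : √(t n) ≤ δ n / 2000 := by
    rw [Real.sqrt_le_left (by positivity)]
    linarith
  have hpath := DysonGap.abs_path_sub_le hconv.measurable_density hconv.density_nonneg
    hconv.eq_withDensity ht0 xs
  have hclose : ∀ w : ℝ, |w| ≤ M' → |DysonGap.path μ ψ (t n) xs + ε n * w - xs| ≤ δ n / 1000 := by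
    intro w hw
    have h1 : |ε n * w| ≤ |ε n| * (M' + 1) := by
      rw [abs_mul]
      gcongr
      linarith
    calc _ = |(DysonGap.path μ ψ (t n) xs - xs) + ε n * w| := by ring_nf
      _ ≤ _ := (abs_add_le _ _).trans (by linarith)
  have hker := DysonGap.norm_kernel_le (m := xs) (d := δ n) (R := B' + 1) (by omega) ht0 h hδ0 hδ1
    (by linarith) (fun j => by
      by_contra hj
      exact hgap n j (by rw [← Real.closedBall_eq_Icc, Metric.mem_closedBall, Real.dist_eq]
                         exact not_lt.1 hj))
    (hB' n) (by nlinarith [sq_nonneg (δ n)]) (hclose u hu) (hclose v hv)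
    (by rwa [← Real.closedBall_eq_Icc, Metric.mem_closedBall, Real.dist_eq] at hx₀)
  set k : ℝ := n / (2 * t n) with hk
  have hn1' : (1 : ℝ) ≤ n := by exact_mod_cast hn1
  have hk0 : 0 < k := by positivity
  have hnk : (n : ℝ) = 2 * k * t n := by rw [hk]; field_simp
  have hXn : (n : ℝ) ≤ k * δ n ^ 2 := by
    rw [hnk]
    nlinarith [mul_le_mul_of_nonneg_left htn hk0.le, mul_pos hk0 ht0]
  -- With `X = k δ²`, the bounds `n δ² ≥ 1` and `n ≤ X` absorb the stray factor `k` into `X²`,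
  -- leaving a function of `X` alone.
  have hkX : k ≤ (k * δ n ^ 2) ^ 2 := by
    have h1 : 1 ≤ k * δ n ^ 2 * δ n ^ 2 :=
      hnδ1.trans (mul_le_mul_of_nonneg_right hXn (sq_nonneg _))
    calc k = k * 1 := (mul_one k).symm
      _ ≤ k * (k * δ n ^ 2 * δ n ^ 2) := by gcongr
      _ = _ := by ring
  rw [norm_mul, Complex.norm_real, Real.norm_eq_abs]
  calc _ ≤ δ n * (24 * (B' + 1) * k / δ n * Real.exp (-(k * δ n ^ 2 / 8))) := by gcongr
    _ = 24 * (B' + 1) * (k * Real.exp (-(k * δ n ^ 2 / 8))) := by field_simp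
    _ ≤ 24 * (B' + 1) * ((k * δ n ^ 2) ^ 2 * Real.exp (-(k * δ n ^ 2 / 8))) := by gcongr
    _ < r := hX₀ _ (hnX.trans hXn)
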